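/- Let $\theta>0$ and $p_k=\theta/(\theta+k-1)$ for $k\ge 1$. Let $N$ (a random variable with values in $\{0,1,2,\dots\}$), $U_1,U_2,\dots$ (uniform on $[0,1]$) and $\xi_1,\xi_2,\dots$ (with $\mathbb P(\xi_k=1)=p_k=1-\mathbb P(\xi_k=0)$) be mutually independent. Given $N$, there are $N$ trials, whose epochs $T_1<\dots<T_N$ are the order statistics of $U_1,\dots,U_N$; the trial at $T_k$ is a success if $\xi_k=1$. Let $N_t=\#\{n\le N: U_n\le t\}$ and let $\mathcal F_t$ be the $\sigma$-algebra generated by the epochs and outcomes of the trials on $[0,t]$. A stopping strategy is a random variable $\tau$ with values in $\{T_1,\dots,T_N,1\}$ such that $\{\tau\le t\}\in\mathcal F_t$ for all $t\in[0,1]$, where $\tau=1$ means not stopping. The strategy $\tau$ wins if $\tau=T_k<1$, where $T_k$ is the epoch of the last success. The strategy with single cutoff $b$ stops at the first success whose epoch is at least $b$ (and does not stop if there is none). Consider any family of such problems with the same $\theta$ along which $N\to\infty$ in probability, that is, $\mathbb P(N\ge K)\to1$ for every $K$. Then the strategy with single cutoff $e^{-1/\theta}$ is a stopping strategy that stops only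 at successes, and its winning probability (the probability that it stops at the last success) converges to $e^{-1}$. Moreover, the optimal winning probability, i.e. the supremum of the winning probabilities over all stopping strategies, also converges to $e^{-1}$. -/

import Mathlib

open MeasureTheory ProbabilityTheory Filter Topology unitInterval

namespace LastSuccess

noncomputable section

/-- The success profile `p_k = θ / (θ + k - 1)`, `k ≥ 1`. -/
def profile (θ : ℝ) (k : ℕ) : ℝ := θ / (θ + k - 1)

/-- The probabilistic setting of the last-success problem with success profile `p`.
`N` is the random number of trials (its law is the prior), `U 1, U 2, …` are the unordered epochs,
and `ξ k` tells whether the trial with (chronological) index `k ≥ 1` is a success.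
All the random variables `N, U 1, U 2, …, ξ 1, ξ 2, …` are mutually independent, each `U n` is
uniform on `[0,1]` and `ξ k` is Bernoulli with parameter `p k`.
Index `0` of `U` and `ξ` plays no role. -/
structure IsModel {Ω : Type*} [MeasurableSpace Ω] (p : ℕ → ℝ) (P : Measure Ω)
    (N : Ω → ℕ) (U : ℕ → Ω → I) (ξ : ℕ → Ω → Bool) : Prop where
  measurable_N : Measurable N
  measurable_U : ∀ n, 1 ≤ n → Measurable (U n)
  measurable_ξ : ∀ k, 1 ≤ k → Measurable (ξ k)
  law_U : ∀ n, 1 ≤ n → P.map (U n) = volume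
  law_ξ : ∀ k, 1 ≤ k → P {ω | ξ k ω = true} = ENNReal.ofReal (p k)
  indep_U : iIndepFun (fun n : ℕ => U (n + 1)) P
  indep_ξ : iIndepFun (fun k : ℕ => ξ (k + 1)) P
  indep_U_ξ : IndepFun (fun ω (n : ℕ) => U (n + 1) ω) (fun ω (k : ℕ) => ξ (k + 1) ω) P
  indep_N : IndepFun N
    (fun ω => ((fun n : ℕ => U (n + 1) ω), (fun k : ℕ => ξ (k + 1) ω))) P

section Pathwise

variable {Ω : Type*} (N : Ω → ℕ) (U : ℕ → Ω → I) (ξ : ℕ → Ω → Bool)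

/-- The mixed binomial counting process `N_t = ∑_{n=1}^N 1{U_n ≤ t}`. -/
def count (t : I) (ω : Ω) : ℕ := ((Finset.Icc 1 (N ω)).filter (fun n => U n ω ≤ t)).card

/-- The chronologically ordered epochs: for `1 ≤ k ≤ N`, `T_k` is the `k`-th order statistic of
`U_1, …, U_N`. (For `k > N` the epoch is undefined and never used;
here the infimum is over the empty set.) -/
def epoch (k : ℕ) (ω : Ω) : I := sInf {t : I | k ≤ count N U t ω}

/-- What is observed by time `s`: the number of trials so far, and the outcomes of these trials. -/
def observed (s : I) (ω : Ω) : ℕ × (ℕ → Bool) :=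
  (count N U s ω, fun k => decide (1 ≤ k ∧ k ≤ count N U s ω) && ξ k ω)

/-- The natural filtration `F_t`, generated by the epochs and outcomes of the trials
on `[0,t]`. -/
abbrev info (t : I) : MeasurableSpace Ω :=
  ⨆ s : I, ⨆ _ : s ≤ t, MeasurableSpace.comap (observed N U ξ s) inferInstance

/-- A stopping strategy: a random time with values in `{T_1, …, T_N, 1}` and adapted to the natural
filtration. The value `1` means not stopping at all. -/
structure IsStrategy (τ : Ω → I) : Prop where
  mem_epochs : ∀ ω, (∃ k, 1 ≤ k ∧ k ≤ N ω ∧ τ ω = epoch N U k ω) ∨ τ ω = 1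
  adapted : ∀ t : I, MeasurableSet[info N U ξ t] {ω | τ ω ≤ t}

/-- The strategy `τ` only stops at epochs of successes. -/
def OnlyStopsAtSuccesses (τ : Ω → I) : Prop :=
  ∀ ω, τ ω < 1 → ∃ k, 1 ≤ k ∧ k ≤ N ω ∧ τ ω = epoch N U k ω ∧ ξ k ω = true

/-- The event that `τ` wins: it stops at the epoch of the last success. -/
def win (τ : Ω → I) : Set Ω :=
  {ω | τ ω < 1 ∧ ∃ k, 1 ≤ k ∧ k ≤ N ω ∧ τ ω = epoch N U k ω ∧ ξ k ω = true ∧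
    ∀ j, k < j → j ≤ N ω → ξ j ω = false}

/-- The strategy with single cutoff `b`: skip all trials before time `b`, then stop at the first
success (and do not stop, i.e. `τ = 1 = sInf ∅`, if there is none). -/
def cutoffStrategy (b : ℝ) (ω : Ω) : I :=
  sInf {t : I | b ≤ (t : ℝ) ∧ ∃ k, 1 ≤ k ∧ k ≤ N ω ∧ t = epoch N U k ω ∧ ξ k ω = true}

/-- The optimal winning probability: the supremum over all stopping strategies. -/
def optimalWin [MeasurableSpace Ω] (P : Measure Ω) : ℝ :=
  sSup {x : ℝ | ∃ τ : Ω → I, IsStrategy N U ξ τ ∧ x = P.real (win N U ξ τ)}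

end Pathwise

end

end LastSuccess

namespace LastSuccess

/-! With k trials behind, trial i + 1 fails with probability i/(θ+i) and has odds θ/i. Hence for 1 ≤
k the product s(k) = `failProb θ k n * oddsSum θ k n` is the probability of exactly one success
among trials k+1, …, n. Since `failProb` is close to exp(-`oddsSum`) for large k, s(k) is about
x·exp(-x) with x the odds sum. This is at most 1/e, with equality at x = 1.

Upper bound: fix N = n and let the player know n and all epochs in advance (`history`). The outcomes
still to come are independent of this larger information, so the player faces the classical problem
with n known trials. Every supersolution w of its optimality equation bounds the conditional winning
probability by w 0 (`IsModel.real_win_inter_le`). Freezing s below the last index whose odds sum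
exceeds 1 gives such a w with w 0 ≤ 1/e + ε for large n (`exists_supersolution_le`).

Lower bound: the cutoff rule wins whenever exactly one success follows b = exp(-1/θ). Given N = n,
the number k of trials up to b is about bn by Chebyshev, and the remaining odds sum is about
θ·log(n/k) ≈ θ·log(1/b) = 1, so s(k) is about 1/e (`exists_le_failProb_mul_oddsSum`).

Both bounds hold for each n ≥ M, with M depending only on θ and the tolerance. Summing over the
values of N therefore leaves only the error P(N < M), which vanishes along the family whatever the
priors are. -/

/-- The probability that the trials `k + 1, …, n` all fail. -/
noncomputable def failProb (θ : ℝ) (k n : ℕ) : ℝ := ∏ i ∈ Finset.Ico k n, (i : ℝ) / (θ + i)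

/-- The sum of the odds of the trials `k + 1, …, n`. -/
noncomputable def oddsSum (θ : ℝ) (k n : ℕ) : ℝ := ∑ i ∈ Finset.Ico k n, θ / (i : ℝ)

/-! ### Failure products and odds sums -/

theorem profile_succ (θ : ℝ) (i : ℕ) : profile θ (i + 1) = θ / (θ + i) := by
  simp only [profile]
  push_cast
  congr 1
  ring

theorem profile_succ_nonneg {θ : ℝ} (hθ : 0 < θ) (i : ℕ) : 0 ≤ profile θ (i + 1) := by
  rw [profile_succ]
  positivity

theorem one_sub_profile_succ {θ : ℝ} (hθ : 0 < θ) (i : ℕ) :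
    1 - profile θ (i + 1) = i / (θ + i) := by
  have : θ + (i : ℝ) ≠ 0 := by positivity
  rw [profile_succ]
  field_simp
  ring

theorem failProb_nonneg {θ : ℝ} (hθ : 0 < θ) (k n : ℕ) : 0 ≤ failProb θ k n :=
  Finset.prod_nonneg fun i _ => by positivity

theorem oddsSum_nonneg {θ : ℝ} (hθ : 0 < θ) (k n : ℕ) : 0 ≤ oddsSum θ k n :=
  Finset.sum_nonneg fun i _ => by positivity

theorem failProb_eq_mul (θ : ℝ) {k n : ℕ} (h : k < n) :
    failProb θ k n = k / (θ + k) * failProb θ (k + 1) n :=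
  Finset.prod_eq_prod_Ico_succ_bot h _

theorem oddsSum_eq_add (θ : ℝ) {k n : ℕ} (h : k < n) :
    oddsSum θ k n = θ / k + oddsSum θ (k + 1) n :=
  Finset.sum_eq_sum_Ico_succ_bot h _

theorem failProb_mono {θ : ℝ} (hθ : 0 < θ) {j k n : ℕ} (h : j ≤ k) (hkn : k ≤ n) :
    failProb θ j n ≤ failProb θ k n := by
  have h1 : failProb θ j k ≤ 1 := Finset.prod_le_one (fun i _ => by positivity) fun i _ => by
    rw [div_le_one (by positivity)]
    linarith
  calc failProb θ j n = failProb θ j k * failProb θ k n :=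
        (Finset.prod_Ico_consecutive _ h hkn).symm
    _ ≤ 1 * failProb θ k n := mul_le_mul_of_nonneg_right h1 (failProb_nonneg hθ k n)
    _ = failProb θ k n := one_mul _

/-- Condition on trial k+1: it is either the only success or it fails and exactly one success
follows. This is the optimality equation with equality, in the region where accepting a success is
right. -/
theorem failProb_mul_oddsSum_eq {θ : ℝ} (hθ : 0 < θ) {k n : ℕ} (hk : 1 ≤ k) (h : k < n) :
    failProb θ k n * oddsSum θ k n = failProb θ (k + 1) n * oddsSum θ (k + 1) n +
      θ / (θ + k) * (failProb θ (k + 1) n - failProb θ (k + 1) n * oddsSum θ (k + 1) n) := by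
  have h0 : (k : ℝ) ≠ 0 := by positivity
  have h1 : θ + (k : ℝ) ≠ 0 := by positivity
  rw [failProb_eq_mul θ h, oddsSum_eq_add θ h]
  field_simp
  ring

/-- With r = θ/i, log(1+r) ≥ 1 - 1/(1+r) = r - r²/(1+r) ≥ r - r². -/
theorem div_add_le_exp {θ : ℝ} (hθ : 0 < θ) {i : ℕ} (hi : 1 ≤ i) :
    (i : ℝ) / (θ + i) ≤ Real.exp (-(θ / i) + (θ / i) ^ 2) := by
  have h0 : (0 : ℝ) < i := by positivity
  have hr : 0 < θ / (i : ℝ) := by positivity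
  have h1 : (i : ℝ) / (θ + i) = (1 + θ / i)⁻¹ := by field_simp; ring
  rw [h1, inv_le_comm₀ (by positivity) (Real.exp_pos _), ← Real.exp_neg,
    ← Real.le_log_iff_exp_le (by positivity)]
  refine le_trans ?_ (Real.one_sub_inv_le_log_of_pos (by positivity))
  have : (1 + θ / (i : ℝ))⁻¹ = 1 - θ / i + (θ / i) ^ 2 * (1 + θ / i)⁻¹ := by
    field_simp; ring
  rw [this]
  have h2 : (1 + θ / (i : ℝ))⁻¹ ≤ 1 := inv_le_one_of_one_le₀ (by linarith)
  nlinarith [sq_nonneg (θ / (i : ℝ))]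

theorem exp_neg_le_div_add {θ : ℝ} (hθ : 0 < θ) {i : ℕ} (hi : 1 ≤ i) :
    Real.exp (-(θ / i)) ≤ (i : ℝ) / (θ + i) := by
  have h0 : (0 : ℝ) < i := by positivity
  have h1 : (i : ℝ) / (θ + i) = (1 + θ / i)⁻¹ := by field_simp; ring
  rw [h1, Real.exp_neg]
  exact inv_anti₀ (by positivity) (by linarith [Real.add_one_le_exp (θ / (i : ℝ))])

theorem exp_neg_oddsSum_le {θ : ℝ} (hθ : 0 < θ) {k : ℕ} (n : ℕ) (hk : 1 ≤ k) :
    Real.exp (-oddsSum θ k n) ≤ failProb θ k n := by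
  rw [oddsSum, ← Finset.sum_neg_distrib, Real.exp_sum]
  exact Finset.prod_le_prod (fun _ _ => (Real.exp_pos _).le)
    fun i hi => exp_neg_le_div_add hθ (hk.trans (Finset.mem_Ico.1 hi).1)

/-- The quadratic errors satisfy (θ/i)² ≤ (θ/k)(θ/i) for i ≥ k, so their sum is a θ/k fraction of
the odds sum. -/
theorem failProb_le_exp {θ : ℝ} (hθ : 0 < θ) {k : ℕ} (n : ℕ) (hk : 1 ≤ k) :
    failProb θ k n ≤ Real.exp (-oddsSum θ k n + θ / k * oddsSum θ k n) := by
  have h1 : failProb θ k n ≤ Real.exp (∑ i ∈ Finset.Ico k n, (-(θ / (i : ℝ)) + (θ / i) ^ 2)) := by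
    rw [Real.exp_sum]
    exact Finset.prod_le_prod (fun _ _ => by positivity)
      fun i hi => div_add_le_exp hθ (hk.trans (Finset.mem_Ico.1 hi).1)
  refine h1.trans (Real.exp_le_exp.2 ?_)
  rw [Finset.sum_add_distrib, Finset.sum_neg_distrib, oddsSum, Finset.mul_sum]
  refine add_le_add le_rfl (Finset.sum_le_sum fun i hi => ?_)
  have hki : (k : ℝ) ≤ i := by exact_mod_cast (Finset.mem_Ico.1 hi).1
  have hk0 : (0 : ℝ) < k := by exact_mod_cast hk
  rw [sq]
  gcongr

theorem mul_exp_neg_le (x : ℝ) : x * Real.exp (-x) ≤ Real.exp (-1) := by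
  have h := Real.add_one_le_exp (x - 1)
  have h2 : Real.exp (-1) = Real.exp (x - 1) * Real.exp (-x) := by
    rw [← Real.exp_add]; ring_nf
  rw [h2]
  exact mul_le_mul_of_nonneg_right (by linarith) (Real.exp_pos _).le

/-! ### Optimality equation for a known number of trials -/

/-- A supersolution of the optimality equation of the problem with `n` trials. -/
theorem exists_supersolution {θ : ℝ} (hθ : 0 < θ) {K n : ℕ} (hK : 1 ≤ K)
    (h : 1 < oddsSum θ K n) :
    ∃ w : ℕ → ℝ, (∀ k, 0 ≤ w k) ∧ (∀ k < n, w (k + 1) ≤ w k) ∧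
      (∀ k < n, w (k + 1) + θ / (θ + k) * (failProb θ (k + 1) n - w (k + 1)) ≤ w k) ∧
      w 0 ≤ Real.exp (-1) * Real.exp (θ / K * (1 + θ / K)) := by
  classical
  have hlt : ∀ j, 1 < oddsSum θ j n → j < n := by
    intro j hj
    by_contra hc
    rw [oddsSum, Finset.Ico_eq_empty (by omega)] at hj
    norm_num at hj
  -- κ is the odds-theorem threshold. Taking the greatest index gives both odds sum > 1 at κ and ≤ 1
  -- beyond it; κ ≥ K ≥ 1 avoids the junk odds θ/0 and makes θ/κ small.
  let κ := Nat.findGreatest (fun j => 1 < oddsSum θ j n) n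
  have hκ1 : 1 < oddsSum θ κ n :=
    Nat.findGreatest_spec (P := fun j => 1 < oddsSum θ j n) (hlt K h).le h
  have hKκ : K ≤ κ := Nat.le_findGreatest (hlt K h).le h
  have hκn : κ < n := hlt κ hκ1
  have hle : ∀ j, κ < j → oddsSum θ j n ≤ 1 := by
    intro j hj
    by_contra! hc
    exact absurd (Nat.le_findGreatest (P := fun j => 1 < oddsSum θ j n) (hlt j hc).le hc)
      (not_le.2 hj)
  have hsle : ∀ k, failProb θ (k + 1) n * oddsSum θ (k + 1) n ≤ failProb θ (k + 1) n ∨ k < κ := by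
    intro k
    rcases lt_or_ge k κ with hk | hk
    · exact Or.inr hk
    · exact Or.inl (mul_le_of_le_one_right (failProb_nonneg hθ _ _) (hle _ (by omega)))
  refine ⟨fun k => failProb θ (max k κ) n * oddsSum θ (max k κ) n,
    fun k => mul_nonneg (failProb_nonneg hθ _ _) (oddsSum_nonneg hθ _ _), ?_, ?_, ?_⟩
  · intro k hk
    rcases hsle k with h1 | h1
    · rcases lt_or_ge k κ with hk' | hk'
      · simp only [max_eq_right hk'.le, max_eq_right (Nat.succ_le_of_lt hk'), le_refl]
      · simp only [max_eq_left hk', max_eq_left (hk'.trans (Nat.le_succ k))]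
        rw [failProb_mul_oddsSum_eq hθ (by omega) hk]
        have : 0 ≤ θ / (θ + (k : ℝ)) := by positivity
        have := mul_nonneg this (sub_nonneg.2 h1)
        linarith
    · simp only [max_eq_right h1.le, max_eq_right (Nat.succ_le_of_lt h1), le_refl]
  · intro k hk
    rcases lt_or_ge k κ with hk' | hk'
    -- Before κ, w is the constant s(κ), which exceeds the gain `failProb θ (k + 1) n` from stopping
    -- because the odds sum at κ is above 1.
    · simp only [max_eq_right hk'.le, max_eq_right (Nat.succ_le_of_lt hk')]
      have h1 : failProb θ (k + 1) n ≤ failProb θ κ n := failProb_mono hθ hk' hκn.le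
      have h2 : failProb θ κ n ≤ failProb θ κ n * oddsSum θ κ n :=
        le_mul_of_one_le_right (failProb_nonneg hθ _ _) hκ1.le
      have h3 : 0 ≤ θ / (θ + (k : ℝ)) := by positivity
      nlinarith
    · simp only [max_eq_left hk', max_eq_left (hk'.trans (Nat.le_succ k))]
      exact (failProb_mul_oddsSum_eq hθ (by omega) hk).ge
  · simp only [Nat.zero_max]
    have hK0 : (0 : ℝ) < K := by exact_mod_cast hK
    have hKκ' : (K : ℝ) ≤ κ := by exact_mod_cast hKκ
    have hr : θ / (κ : ℝ) ≤ θ / K := by gcongr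
    -- The sum overshoots 1 by at most its first term.
    have hO : oddsSum θ κ n ≤ 1 + θ / K := by
      rw [oddsSum_eq_add θ hκn]
      linarith [hle (κ + 1) (by omega)]
    have h0 := oddsSum_nonneg hθ κ n
    calc failProb θ κ n * oddsSum θ κ n
        ≤ Real.exp (-oddsSum θ κ n + θ / κ * oddsSum θ κ n) * oddsSum θ κ n :=
          mul_le_mul_of_nonneg_right (failProb_le_exp hθ n (by omega)) h0
      _ = oddsSum θ κ n * Real.exp (-oddsSum θ κ n) * Real.exp (θ / κ * oddsSum θ κ n) := by
          rw [Real.exp_add]; ring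
      _ ≤ Real.exp (-1) * Real.exp (θ / K * (1 + θ / K)) := by
          refine mul_le_mul (mul_exp_neg_le _) (Real.exp_le_exp.2 ?_) (Real.exp_pos _).le
            (Real.exp_pos _).le
          exact mul_le_mul hr hO h0 (by positivity)

/-! ### Asymptotics of the odds sum -/

/-- Sum 1/(n+1) ≤ log((n+1)/n) ≤ 1/n; the gaps between the outer terms telescope to 1/k - 1/n. -/
theorem oddsSum_bounds {θ : ℝ} (hθ : 0 < θ) {k n : ℕ} (hk : 1 ≤ k) (h : k ≤ n) :
    θ * Real.log (n / k) ≤ oddsSum θ k n ∧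
      oddsSum θ k n ≤ θ * Real.log (n / k) + θ * (1 / k - 1 / n) := by
  have hk0 : (0 : ℝ) < k := by exact_mod_cast hk
  induction n, h using Nat.le_induction with
  | base => simp [oddsSum, div_self hk0.ne']
  | succ n hn ih =>
    have hn0 : (0 : ℝ) < n := by exact_mod_cast (hk.trans hn)
    have hs : oddsSum θ k (n + 1) = oddsSum θ k n + θ * (1 / n) := by
      rw [oddsSum, Finset.sum_Ico_succ_top hn, oddsSum]
      ring
    have hlog : Real.log (((n + 1 : ℕ) : ℝ) / k) = Real.log (n / k) + Real.log ((n + 1) / n) := by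
      rw [← Real.log_mul (by positivity) (by positivity)]
      congr 1
      push_cast
      field_simp
    have hup : Real.log (((n : ℝ) + 1) / n) ≤ 1 / n := by
      refine (Real.log_le_sub_one_of_pos (by positivity)).trans (le_of_eq ?_)
      field_simp
      ring
    have hlo : 1 / ((n : ℝ) + 1) ≤ Real.log (((n : ℝ) + 1) / n) := by
      refine (le_of_eq ?_).trans (Real.one_sub_inv_le_log_of_pos (by positivity))
      field_simp
      ring
    rw [hs, hlog]
    push_cast
    constructor <;> nlinarith [ih.1, ih.2, mul_le_mul_of_nonneg_left hup hθ.le,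
      mul_le_mul_of_nonneg_left hlo hθ.le]

theorem exists_one_lt_oddsSum {θ : ℝ} (hθ : 0 < θ) {K : ℕ} (hK : 1 ≤ K) :
    ∃ M : ℕ, ∀ n, M ≤ n → 1 < oddsSum θ K n := by
  have hK0 : (0 : ℝ) < K := by exact_mod_cast hK
  have ht : Tendsto (fun n : ℕ => θ * Real.log ((n : ℝ) / K)) atTop atTop :=
    ((Real.tendsto_log_atTop.comp
      (tendsto_natCast_atTop_atTop.atTop_div_const hK0)).const_mul_atTop hθ)
  obtain ⟨M, hM⟩ := eventually_atTop.1 (ht.eventually_gt_atTop 1)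
  exact ⟨max M K, fun n hn => (hM n (le_of_max_le_left hn)).trans_le
    (oddsSum_bounds hθ hK (le_of_max_le_right hn)).1⟩

/-- The value of the problem with a large known number of trials is at most `e⁻¹ + ε`. -/
theorem exists_supersolution_le {θ : ℝ} (hθ : 0 < θ) {ε : ℝ} (hε : 0 < ε) :
    ∃ M : ℕ, ∀ n, M ≤ n → ∃ w : ℕ → ℝ, (∀ k, 0 ≤ w k) ∧ (∀ k < n, w (k + 1) ≤ w k) ∧
      (∀ k < n, w (k + 1) + θ / (θ + k) * (failProb θ (k + 1) n - w (k + 1)) ≤ w k) ∧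
      w 0 ≤ Real.exp (-1) + ε := by
  have hr : Tendsto (fun K : ℕ => θ / (K : ℝ)) atTop (𝓝 0) :=
    tendsto_const_div_atTop_nhds_zero_nat θ
  have ht : Tendsto (fun K : ℕ => Real.exp (-1) * Real.exp (θ / K * (1 + θ / K))) atTop
      (𝓝 (Real.exp (-1))) := by
    have := ((Real.continuous_exp.tendsto _).comp (hr.mul (hr.const_add 1))).const_mul
      (Real.exp (-1))
    simpa using this
  obtain ⟨K, hK, hK1⟩ := ((ht.eventually_le_const
    (lt_add_of_pos_right (Real.exp (-1)) hε)).and (eventually_ge_atTop 1)).exists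
  obtain ⟨M, hM⟩ := exists_one_lt_oddsSum hθ hK1
  refine ⟨M, fun n hn => ?_⟩
  obtain ⟨w, h1, h2, h3, h4⟩ := exists_supersolution hθ hK1 (hM n hn)
  exact ⟨w, h1, h2, h3, h4.trans hK⟩

/-- If the fraction `k / n` is close to `exp (-1 / θ)` then the probability of exactly one success
in the trials `k + 1, …, n` is at least `e⁻¹ - ε`. -/
theorem exists_le_failProb_mul_oddsSum {θ : ℝ} (hθ : 0 < θ) {ε : ℝ} (hε : 0 < ε) :
    ∃ δ > 0, ∃ M : ℕ, ∀ n k : ℕ, M ≤ n → 1 ≤ n → k ≤ n →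
      |(k : ℝ) / n - Real.exp (-1 / θ)| < δ →
      1 ≤ k ∧ Real.exp (-1) - ε ≤ failProb θ k n * oddsSum θ k n := by
  set b := Real.exp (-1 / θ) with hb
  have hb0 : 0 < b := Real.exp_pos _
  have hg : ∀ᶠ x in 𝓝 (1 : ℝ), Real.exp (-1) - ε < x * Real.exp (-x) := by
    have : Tendsto (fun x : ℝ => x * Real.exp (-x)) (𝓝 1) (𝓝 (1 * Real.exp (-1))) :=
      Continuous.tendsto (by fun_prop) 1
    rw [one_mul] at this
    exact this.eventually_const_lt (by linarith)
  obtain ⟨η, hη, hη'⟩ := Metric.eventually_nhds_iff.1 hg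
  have hl : ∀ᶠ y in 𝓝 b, |-θ * Real.log y - 1| < η / 2 := by
    have : Tendsto (fun y : ℝ => |-θ * Real.log y - 1|) (𝓝 b) (𝓝 |-θ * Real.log b - 1|) :=
      (((Real.continuousAt_log hb0.ne').tendsto.const_mul (-θ)).sub_const 1).abs
    refine this.eventually_lt_const ?_
    rw [hb, Real.log_exp, show -θ * (-1 / θ) - 1 = 0 by field_simp; ring, abs_zero]
    positivity
  obtain ⟨δ, hδ, hδ'⟩ := Metric.eventually_nhds_iff.1 (hl.and (lt_mem_nhds (half_lt_self hb0)))
  -- Half of η pays for replacing k/n by b in the logarithm, half for the harmonic error, at most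
  -- θ/k. As k > bn/2, this M makes θ/k ≤ η/2.
  obtain ⟨M, hM⟩ := exists_nat_gt (2 * θ / (b / 2 * η))
  refine ⟨δ, hδ, M, fun n k hMn hn hkn hd => ?_⟩
  have hn0 : (0 : ℝ) < n := by exact_mod_cast hn
  obtain ⟨h1, h2⟩ := hδ' (y := (k : ℝ) / n) (by simpa [Real.dist_eq] using hd)
  have hbk : b / 2 * n < k := by rwa [lt_div_iff₀ hn0] at h2
  have hk0 : (0 : ℝ) < k := by have := mul_pos (half_pos hb0) hn0; linarith
  have hk : 1 ≤ k := by exact_mod_cast hk0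
  refine ⟨hk, ?_⟩
  have hO := oddsSum_bounds hθ hk hkn
  have hlog : -θ * Real.log ((k : ℝ) / n) = θ * Real.log (n / k) := by
    rw [← inv_div, Real.log_inv]; ring
  rw [hlog] at h1
  have hMn' : (M : ℝ) ≤ n := by exact_mod_cast hMn
  have hsmall : θ * (1 / k - 1 / n) ≤ η / 2 := by
    have h3 : θ * (1 / k - 1 / n) ≤ θ / k := by
      rw [mul_sub, mul_one_div]
      have : 0 ≤ θ * (1 / (n : ℝ)) := by positivity
      linarith
    refine h3.trans ?_
    rw [div_le_iff₀ hk0]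
    rw [div_lt_iff₀ (by positivity)] at hM
    have h4 : (M : ℝ) * (b / 2 * η) ≤ n * (b / 2 * η) := by gcongr
    nlinarith
  have hdist : dist (oddsSum θ k n) 1 < η := by
    rw [Real.dist_eq, abs_lt]
    rw [abs_lt] at h1
    constructor <;> linarith [hO.1, hO.2, h1.1, h1.2]
  have := hη' hdist
  have h5 := mul_le_mul_of_nonneg_right (exp_neg_oddsSum_le hθ n hk) (oddsSum_nonneg hθ k n)
  linarith

/-! ### Independence of future outcomes from the enlarged history -/

/-- Associativity of the product of the three laws. It regroups N, epochs and outcomes into past and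
future. -/
theorem indepFun_prodMk_of_indepFun {Ω α β γ : Type*} [MeasurableSpace Ω] [MeasurableSpace α]
    [MeasurableSpace β] [MeasurableSpace γ] {P : Measure Ω} [IsProbabilityMeasure P]
    {X : Ω → α} {Y : Ω → β} {Z : Ω → γ} (hX : Measurable X) (hY : Measurable Y)
    (hZ : Measurable Z) (h : IndepFun X (fun ω => (Y ω, Z ω)) P) (hYZ : IndepFun Y Z P) :
    IndepFun (fun ω => (X ω, Y ω)) Z P := by
  have hXY : IndepFun X Y P := h.comp measurable_id measurable_fst
  have := Measure.isProbabilityMeasure_map (μ := P) hX.aemeasurable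
  have := Measure.isProbabilityMeasure_map (μ := P) hY.aemeasurable
  have := Measure.isProbabilityMeasure_map (μ := P) hZ.aemeasurable
  rw [indepFun_iff_map_prod_eq_prod_map_map hX.aemeasurable (hY.prodMk hZ).aemeasurable] at h
  rw [indepFun_iff_map_prod_eq_prod_map_map hY.aemeasurable hZ.aemeasurable] at hYZ
  rw [indepFun_iff_map_prod_eq_prod_map_map hX.aemeasurable hY.aemeasurable] at hXY
  rw [indepFun_iff_map_prod_eq_prod_map_map (hX.prodMk hY).aemeasurable hZ.aemeasurable, hXY]
  have h1 := congrArg (Measure.map (MeasurableEquiv.prodAssoc (α := α) (β := β) (γ := γ)).symm) h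
  rw [hYZ, Measure.map_map (MeasurableEquiv.measurable _) (hX.prodMk (hY.prodMk hZ)),
    ← Measure.prodAssoc_prod, Measure.map_map (MeasurableEquiv.measurable _)
      (MeasurableEquiv.measurable _), MeasurableEquiv.symm_comp_self, Measure.map_id] at h1
  exact h1

section Model

variable {Ω : Type*} [MeasurableSpace Ω] {θ : ℝ} {P : Measure Ω}
  {N : Ω → ℕ} {U : ℕ → Ω → I} {ξ : ℕ → Ω → Bool}

/-- The number of trials, all the epochs, and the outcomes of the first `k` trials. -/
def history (N : Ω → ℕ) (U : ℕ → Ω → I) (ξ : ℕ → Ω → Bool) (k : ℕ) (ω : Ω) :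
    (ℕ × (ℕ → I)) × (Finset.range k → Bool) :=
  ((N ω, fun n => U (n + 1) ω), fun i => ξ (i + 1) ω)

/-- The `σ`-algebra generated by `history`. -/
abbrev historySigma (N : Ω → ℕ) (U : ℕ → Ω → I) (ξ : ℕ → Ω → Bool) (k : ℕ) : MeasurableSpace Ω :=
  MeasurableSpace.comap (history N U ξ k) inferInstance

theorem IsModel.indepFun_history [IsProbabilityMeasure P] {p : ℕ → ℝ} (h : IsModel p P N U ξ)
    (k n : ℕ) :
    IndepFun (history N U ξ k) (fun ω (i : Finset.Ico k n) => ξ (i + 1) ω) P := by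
  have mU : Measurable fun ω (n : ℕ) => U (n + 1) ω :=
    measurable_pi_lambda _ fun n => h.measurable_U _ (by omega)
  have mξ : Measurable fun ω (n : ℕ) => ξ (n + 1) ω :=
    measurable_pi_lambda _ fun n => h.measurable_ξ _ (by omega)
  have hNU := indepFun_prodMk_of_indepFun h.measurable_N mU mξ h.indep_N h.indep_U_ξ
  have hdisj : Disjoint (Finset.range k) (Finset.Ico k n) := by
    rw [Finset.disjoint_left]
    intro i hi hi'
    simp only [Finset.mem_range, Finset.mem_Ico] at hi hi'
    omega
  have hblock := h.indep_ξ.indepFun_finset _ _ hdisj fun i => h.measurable_ξ _ (by omega)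
  refine indepFun_prodMk_of_indepFun (h.measurable_N.prodMk mU)
    (measurable_pi_lambda _ fun i => h.measurable_ξ _ (by omega))
    (measurable_pi_lambda _ fun i => h.measurable_ξ _ (by omega)) ?_ hblock
  exact hNU.comp (φ := id) (ψ := fun x : ℕ → Bool =>
    ((fun i : Finset.range k => x i), fun i : Finset.Ico k n => x i)) measurable_id (by fun_prop)

theorem IsModel.measurable_history {p : ℕ → ℝ} (h : IsModel p P N U ξ) (k : ℕ) :
    Measurable (history N U ξ k) :=
  (h.measurable_N.prodMk (measurable_pi_lambda _ fun n => h.measurable_U _ (by omega))).prodMk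
    (measurable_pi_lambda _ fun i => h.measurable_ξ _ (by omega))

theorem IsModel.historySigma_le {p : ℕ → ℝ} (h : IsModel p P N U ξ) (k : ℕ) :
    historySigma N U ξ k ≤ ‹MeasurableSpace Ω› :=
  (h.measurable_history k).comap_le

theorem IsModel.real_outcome [IsProbabilityMeasure P] (hθ : 0 < θ)
    (h : IsModel (profile θ) P N U ξ) (i : ℕ) (e : Bool) :
    P.real (ξ (i + 1) ⁻¹' {e}) = if e then profile θ (i + 1) else 1 - profile θ (i + 1) := by
  have ht : P.real (ξ (i + 1) ⁻¹' {true}) = profile θ (i + 1) := by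
    have : ξ (i + 1) ⁻¹' {true} = {ω | ξ (i + 1) ω = true} := rfl
    rw [this, measureReal_def, h.law_ξ _ (by omega),
      ENNReal.toReal_ofReal (profile_succ_nonneg hθ i)]
  cases e
  · have : ξ (i + 1) ⁻¹' {false} = (ξ (i + 1) ⁻¹' {true})ᶜ := by
      ext ω; simp
    rw [this, probReal_compl_eq_one_sub (h.measurable_ξ _ (by omega) (measurableSet_singleton _)),
      ht]
    simp
  · simpa using ht

theorem IsModel.real_inter_outcomes [IsProbabilityMeasure P] (hθ : 0 < θ)
    (h : IsModel (profile θ) P N U ξ) {k : ℕ} (n : ℕ) {C : Set Ω}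
    (hC : MeasurableSet[historySigma N U ξ k] C) (e : ℕ → Bool) :
    P.real (C ∩ {ω | ∀ i ∈ Finset.Ico k n, ξ (i + 1) ω = e i}) =
      P.real C * ∏ i ∈ Finset.Ico k n,
        (if e i then profile θ (i + 1) else 1 - profile θ (i + 1)) := by
  obtain ⟨B, hB, rfl⟩ := hC
  have h1 := (h.indepFun_history k n).measure_inter_preimage_eq_mul B
    {fun i : Finset.Ico k n => e i} hB (measurableSet_singleton _)
  have h2 : (fun ω (i : Finset.Ico k n) => ξ (i + 1) ω) ⁻¹' {fun i : Finset.Ico k n => e i} =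
      {ω | ∀ i ∈ Finset.Ico k n, ξ (i + 1) ω = e i} := by
    ext ω
    simp [funext_iff]
  have h3 : {ω | ∀ i ∈ Finset.Ico k n, ξ (i + 1) ω = e i} =
      ⋂ i ∈ Finset.Ico k n, ξ (i + 1) ⁻¹' {e i} := by
    ext ω
    simp
  have h4 := h.indep_ξ.measure_inter_preimage_eq_mul (Finset.Ico k n) (sets := fun i => {e i})
    fun i _ => measurableSet_singleton _
  rw [h2, h3, h4] at h1
  rw [h3, measureReal_def, h1, ENNReal.toReal_mul, ENNReal.toReal_prod]
  congr 1
  exact Finset.prod_congr rfl fun i _ => h.real_outcome hθ i (e i)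

theorem IsModel.real_inter_fail [IsProbabilityMeasure P] (hθ : 0 < θ)
    (h : IsModel (profile θ) P N U ξ) {k : ℕ} (n : ℕ) {C : Set Ω}
    (hC : MeasurableSet[historySigma N U ξ k] C) :
    P.real (C ∩ {ω | ∀ i ∈ Finset.Ico k n, ξ (i + 1) ω = false}) =
      P.real C * failProb θ k n := by
  rw [h.real_inter_outcomes hθ n hC fun _ => false, failProb]
  simp [one_sub_profile_succ hθ]

theorem IsModel.real_inter_success [IsProbabilityMeasure P] (hθ : 0 < θ)
    (h : IsModel (profile θ) P N U ξ) {k : ℕ} {C : Set Ω}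
    (hC : MeasurableSet[historySigma N U ξ k] C) :
    P.real (C ∩ {ω | ξ (k + 1) ω = true}) = P.real C * (θ / (θ + k)) := by
  have := h.real_inter_outcomes hθ (k + 1) hC fun _ => true
  simpa [profile_succ] using this

theorem IsModel.measurableSet_outcomes {p : ℕ → ℝ} (h : IsModel p P N U ξ) (k n : ℕ)
    (e : ℕ → Bool) : MeasurableSet {ω | ∀ i ∈ Finset.Ico k n, ξ (i + 1) ω = e i} := by
  have : {ω | ∀ i ∈ Finset.Ico k n, ξ (i + 1) ω = e i} =
      ⋂ i ∈ Finset.Ico k n, ξ (i + 1) ⁻¹' {e i} := by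
    ext ω
    simp
  rw [this]
  exact Finset.measurableSet_biInter _ fun i _ =>
    h.measurable_ξ _ (by omega) (measurableSet_singleton _)

/-- There is exactly one success in the trials `k + 1, …, n`. -/
def oneSuccess (ξ : ℕ → Ω → Bool) (k n : ℕ) : Set Ω :=
  ⋃ j ∈ Finset.Ico k n, {ω | ∀ i ∈ Finset.Ico k n, ξ (i + 1) ω = decide (i = j)}

theorem IsModel.measurableSet_oneSuccess {p : ℕ → ℝ} (h : IsModel p P N U ξ) (k n : ℕ) :
    MeasurableSet (oneSuccess ξ k n) :=
  Finset.measurableSet_biUnion _ fun j _ => h.measurableSet_outcomes k n fun i => decide (i = j)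

/-- Making trial j+1 the only success replaces the factor j/(θ+j) of the failure product by θ/(θ+j),
that is, multiplies it by the odds θ/j. This needs j ≠ 0, hence 1 ≤ k. -/
theorem IsModel.real_inter_oneSuccess [IsProbabilityMeasure P] (hθ : 0 < θ)
    (h : IsModel (profile θ) P N U ξ) {k : ℕ} (hk : 1 ≤ k) (n : ℕ) {C : Set Ω}
    (hC : MeasurableSet[historySigma N U ξ k] C) :
    P.real (C ∩ oneSuccess ξ k n) = P.real C * (failProb θ k n * oddsSum θ k n) := by
  have hC' := h.historySigma_le k _ hC
  rw [oneSuccess, Set.inter_iUnion₂, measureReal_biUnion_finset]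
  · rw [oddsSum, Finset.mul_sum, Finset.mul_sum]
    refine Finset.sum_congr rfl fun j hj => ?_
    rw [h.real_inter_outcomes hθ n hC fun i => decide (i = j)]
    congr 1
    have hj0 : (j : ℝ) ≠ 0 := by
      have := (Finset.mem_Ico.1 hj).1
      exact_mod_cast (by omega : j ≠ 0)
    have h0 : θ + (j : ℝ) ≠ 0 := by positivity
    rw [failProb, ← Finset.mul_prod_erase _ _ hj, ← Finset.mul_prod_erase _ _ hj]
    have : ∏ i ∈ (Finset.Ico k n).erase j, (if decide (i = j) = true then profile θ (i + 1)
        else 1 - profile θ (i + 1)) = ∏ i ∈ (Finset.Ico k n).erase j, (i : ℝ) / (θ + i) :=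
      Finset.prod_congr rfl fun i hi => by
        simp [(Finset.mem_erase.1 hi).1, one_sub_profile_succ hθ]
    rw [this]
    simp only [decide_true, if_true, profile_succ]
    field_simp
  · intro j hj j' hj' hne
    rw [Function.onFun, Set.disjoint_left]
    rintro ω ⟨-, h1⟩ ⟨-, h2⟩
    have h1' := h1 j hj
    have h2' := h2 j hj
    simp only [decide_true] at h1'
    rw [h1'] at h2'
    simp only [true_eq_decide_iff] at h2'
    exact hne h2'
  · intro j _
    exact hC'.inter (h.measurableSet_outcomes k n fun i => decide (i = j))

end Model

/-! ### Order statistics and the cutoff rule, path by path -/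

section Pathwise

variable {Ω : Type*} {N : Ω → ℕ} {U : ℕ → Ω → I} {ξ : ℕ → Ω → Bool}

theorem count_mono {s t : I} (h : s ≤ t) (ω : Ω) : count N U s ω ≤ count N U t ω :=
  Finset.card_le_card (Finset.monotone_filter_right _ fun _ _ hn => le_trans hn h)

theorem count_le (t : I) (ω : Ω) : count N U t ω ≤ N ω :=
  (Finset.card_filter_le _ _).trans (by simp)

theorem count_one (ω : Ω) : count N U 1 ω = N ω := by
  rw [count, Finset.filter_true_of_mem fun n _ => unitInterval.le_one', Nat.card_Icc]
  omega

/-- The count is right-continuous: the times with count at least k form a finite union of closed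
sets. So the infimum defining the epoch is attained, and k ≤ N makes the set contain 1. -/
theorem epoch_le_iff {k : ℕ} {ω : Ω} (hk : k ≤ N ω) (t : I) :
    epoch N U k ω ≤ t ↔ k ≤ count N U t ω := by
  have hcl : IsClosed {t : I | k ≤ count N U t ω} := by
    have : {t : I | k ≤ count N U t ω} =
        ⋃ A ∈ (Finset.Icc 1 (N ω)).powerset.filter (fun A => k ≤ A.card),
          ⋂ n ∈ A, Set.Ici (U n ω) := by
      ext t
      simp only [Set.mem_ofPred_eq, Set.mem_iUnion, Set.mem_iInter, Set.mem_Ici, exists_prop,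
        Finset.mem_filter, Finset.mem_powerset]
      constructor
      · intro h
        exact ⟨_, ⟨Finset.filter_subset _ _, h⟩, fun n hn => (Finset.mem_filter.1 hn).2⟩
      · rintro ⟨A, ⟨hA, hkA⟩, h⟩
        exact hkA.trans (Finset.card_le_card fun n hn => Finset.mem_filter.2 ⟨hA hn, h n hn⟩)
    rw [this]
    exact Set.Finite.isClosed_biUnion (Finset.finite_toSet _)
      fun A _ => isClosed_biInter fun n _ => isClosed_Ici
  have hmem : epoch N U k ω ∈ {t : I | k ≤ count N U t ω} :=
    hcl.csInf_mem ⟨1, by simpa [count_one] using hk⟩ (OrderBot.bddBelow _)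
  exact ⟨fun h => le_trans hmem (count_mono h ω), fun h => csInf_le (OrderBot.bddBelow _) h⟩

/-- The largest of the points before t already has count at least k. -/
theorem epoch_lt_of_le_card {k : ℕ} {ω : Ω} (hk1 : 1 ≤ k) {t : I}
    (h : k ≤ ((Finset.Icc 1 (N ω)).filter fun n => U n ω < t).card) : epoch N U k ω < t := by
  set A := (Finset.Icc 1 (N ω)).filter fun n => U n ω < t
  have hne : A.Nonempty := Finset.card_pos.1 (by omega)
  obtain ⟨m, hm, hmax⟩ := A.exists_max_image (fun n => U n ω) hne
  refine lt_of_le_of_lt ?_ (Finset.mem_filter.1 hm).2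
  have hk : k ≤ N ω := h.trans ((Finset.card_filter_le _ _).trans (by simp))
  rw [epoch_le_iff hk]
  exact h.trans (Finset.card_le_card fun n hn =>
    Finset.mem_filter.2 ⟨(Finset.mem_filter.1 hn).1, hmax n hn⟩)

theorem exists_eq_epoch {k : ℕ} {ω : Ω} (hk1 : 1 ≤ k) (hk : k ≤ N ω) :
    ∃ n, 1 ≤ n ∧ U n ω = epoch N U k ω := by
  by_contra! hc
  refine lt_irrefl (epoch N U k ω) (epoch_lt_of_le_card hk1 ?_)
  refine ((epoch_le_iff (U := U) hk _).1 le_rfl).trans (Finset.card_le_card fun n hn => ?_)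
  obtain ⟨hn1, hn2⟩ := Finset.mem_filter.1 hn
  exact Finset.mem_filter.2 ⟨hn1, lt_of_le_of_ne hn2 (hc n (Finset.mem_Icc.1 hn1).1)⟩

theorem epoch_lt_epoch_succ {k : ℕ} {ω : Ω} (hk1 : 1 ≤ k) (hk : k + 1 ≤ N ω)
    (hinj : ∀ i j, 1 ≤ i → 1 ≤ j → U i ω = U j ω → i = j) :
    epoch N U k ω < epoch N U (k + 1) ω := by
  refine epoch_lt_of_le_card hk1 ?_
  set t := epoch N U (k + 1) ω
  have h1 : k + 1 ≤ count N U t ω := (epoch_le_iff hk _).1 le_rfl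
  have h2 : count N U t ω = ((Finset.Icc 1 (N ω)).filter fun n => U n ω < t).card +
      ((Finset.Icc 1 (N ω)).filter fun n => U n ω = t).card := by
    rw [count, ← Finset.card_union_of_disjoint]
    · congr 1
      ext n
      simp only [Finset.mem_union, Finset.mem_filter, le_iff_lt_or_eq]
      tauto
    · rw [Finset.disjoint_filter]
      intro n _ h
      exact h.ne
  have h3 : ((Finset.Icc 1 (N ω)).filter fun n => U n ω = t).card ≤ 1 := by
    rw [Finset.card_le_one]
    intro i hi j hj
    simp only [Finset.mem_filter, Finset.mem_Icc] at hi hj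
    exact hinj i j hi.1.1 hj.1.1 (hi.2.trans hj.2.symm)
  omega

theorem cutoffStrategy_mem_or_eq_one (N : Ω → ℕ) (U : ℕ → Ω → I) (ξ : ℕ → Ω → Bool)
    (b : ℝ) (ω : Ω) :
    (b ≤ (cutoffStrategy N U ξ b ω : ℝ) ∧ ∃ k, 1 ≤ k ∧ k ≤ N ω ∧
      cutoffStrategy N U ξ b ω = epoch N U k ω ∧ ξ k ω = true) ∨
      cutoffStrategy N U ξ b ω = 1 := by
  set S := {t : I | b ≤ (t : ℝ) ∧ ∃ k, 1 ≤ k ∧ k ≤ N ω ∧ t = epoch N U k ω ∧ ξ k ω = true} with hS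
  have hfin : S.Finite := by
    refine ((Finset.Icc 1 (N ω)).image fun k => epoch N U k ω).finite_toSet.subset ?_
    rintro t ⟨-, k, h1, h2, h3, -⟩
    simp only [Finset.coe_image, Set.mem_image, Finset.coe_Icc, Set.mem_Icc]
    exact ⟨k, ⟨h1, h2⟩, h3.symm⟩
  rcases S.eq_empty_or_nonempty with h | h
  · right
    rw [cutoffStrategy, ← hS, h, sInf_empty]
    rfl
  · exact Or.inl (h.csInf_mem hfin)

theorem cutoffStrategy_le_iff (b : I) {t : I} (ht : t < 1) (ω : Ω) :
    cutoffStrategy N U ξ b ω ≤ t ↔ ∃ k, 1 ≤ k ∧ k ≤ N ω ∧ b ≤ epoch N U k ω ∧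
      epoch N U k ω ≤ t ∧ ξ k ω = true := by
  constructor
  · intro h
    rcases cutoffStrategy_mem_or_eq_one N U ξ b ω with ⟨h1, k, h2, h3, h4, h5⟩ | h1
    · exact ⟨k, h2, h3, by rw [← h4]; exact h1, h4 ▸ h, h5⟩
    · exact absurd (h1 ▸ h) (not_le.2 ht)
  · rintro ⟨k, h1, h2, h3, h4, h5⟩
    have hmem : epoch N U k ω ∈ {t : I | (b : ℝ) ≤ (t : ℝ) ∧
        ∃ k, 1 ≤ k ∧ k ≤ N ω ∧ t = epoch N U k ω ∧ ξ k ω = true} := ⟨h3, k, h1, h2, rfl, h5⟩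
    exact (csInf_le (OrderBot.bddBelow _) hmem).trans h4

/-- Turns a strict inequality into a countable union of events seen before b, as adaptedness of the
cutoff rule requires. -/
theorem epoch_lt_iff_exists_dense {k : ℕ} {ω : Ω} (hk : k ≤ N ω) (b : I) :
    epoch N U k ω < b ↔ ∃ m, TopologicalSpace.denseSeq I m < b ∧
      k ≤ count N U (TopologicalSpace.denseSeq I m) ω := by
  constructor
  · intro h
    obtain ⟨s, ⟨m, rfl⟩, h1, h2⟩ := (TopologicalSpace.denseRange_denseSeq I).exists_between h
    exact ⟨m, h2, (epoch_le_iff hk _).1 h1.le⟩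
  · rintro ⟨m, h1, h2⟩
    exact ((epoch_le_iff hk _).2 h2).trans_lt h1

theorem measurableSet_info_observed {s t : I} (h : s ≤ t) {C : Set (ℕ × (ℕ → Bool))}
    (hC : MeasurableSet C) : MeasurableSet[info N U ξ t] (observed N U ξ s ⁻¹' C) :=
  (le_iSup₂_of_le (f := fun (s : I) (_ : s ≤ t) =>
    MeasurableSpace.comap (observed N U ξ s) inferInstance) s h le_rfl) _ ⟨C, hC, rfl⟩

theorem isStrategy_cutoffStrategy (N : Ω → ℕ) (U : ℕ → Ω → I) (ξ : ℕ → Ω → Bool) (b : I) :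
    IsStrategy N U ξ (cutoffStrategy N U ξ b) := by
  refine ⟨fun ω => (cutoffStrategy_mem_or_eq_one N U ξ b ω).imp
    (fun ⟨_, k, h1, h2, h3, _⟩ => ⟨k, h1, h2, h3⟩) id, fun t => ?_⟩
  rcases lt_or_ge t 1 with ht | ht
  swap
  · have : {ω | cutoffStrategy N U ξ b ω ≤ t} = Set.univ :=
      Set.eq_univ_of_forall fun ω => le_trans unitInterval.le_one' ht
    rw [this]
    exact @MeasurableSet.univ _ (info N U ξ t)
  rcases lt_or_ge t b with hb | hb
  · have : {ω | cutoffStrategy N U ξ b ω ≤ t} = ∅ := by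
      refine Set.eq_empty_of_forall_notMem fun ω hω => ?_
      obtain ⟨k, -, -, h1, h2, -⟩ := (cutoffStrategy_le_iff b ht ω).1 hω
      exact absurd (h1.trans h2) (not_le.2 hb)
    rw [this]
    exact @MeasurableSet.empty _ (info N U ξ t)
  have hset : {ω | cutoffStrategy N U ξ b ω ≤ t} = ⋃ k : ℕ,
      observed N U ξ t ⁻¹' {x | 1 ≤ k ∧ k ≤ x.1 ∧ x.2 k = true} \
        ⋃ m ∈ {m | TopologicalSpace.denseSeq I m < b},
          observed N U ξ (TopologicalSpace.denseSeq I m) ⁻¹' {x | k ≤ x.1} := by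
    ext ω
    rw [Set.mem_ofPred_eq, cutoffStrategy_le_iff b ht, Set.mem_iUnion]
    refine exists_congr fun k => ?_
    simp only [Set.mem_sdiff, Set.mem_preimage, Set.mem_ofPred_eq, Set.mem_iUnion, observed,
      exists_prop, Bool.and_eq_true, decide_eq_true_eq]
    constructor
    · rintro ⟨h1, h2, h3, h4, h5⟩
      rw [epoch_le_iff h2] at h4
      rw [← not_lt, epoch_lt_iff_exists_dense h2] at h3
      exact ⟨⟨h1, h4, ⟨h1, h4⟩, h5⟩, h3⟩
    · rintro ⟨⟨h1, h4, -, h5⟩, h3⟩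
      have h2 := h4.trans (count_le t ω)
      rw [← epoch_lt_iff_exists_dense h2, not_lt] at h3
      exact ⟨h1, h2, h3, (epoch_le_iff h2 t).2 h4, h5⟩
  rw [hset]
  refine MeasurableSet.iUnion fun k => MeasurableSet.diff (measurableSet_info_observed le_rfl ?_)
    (MeasurableSet.biUnion (Set.to_countable _) fun m hm =>
      measurableSet_info_observed ((le_of_lt hm).trans hb) ?_)
  · have h1 : MeasurableSet {x : ℕ × (ℕ → Bool) | k ≤ x.1} :=
      measurable_fst (MeasurableSet.of_discrete (s := {m : ℕ | k ≤ m}))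
    have h2 : MeasurableSet {x : ℕ × (ℕ → Bool) | x.2 k = true} :=
      measurableSet_eq_fun ((measurable_pi_apply k).comp measurable_snd) measurable_const
    exact (MeasurableSet.const _).inter (h1.inter h2)
  · exact measurable_fst (MeasurableSet.of_discrete (s := {m : ℕ | k ≤ m}))

theorem onlyStopsAtSuccesses_cutoffStrategy (N : Ω → ℕ) (U : ℕ → Ω → I) (ξ : ℕ → Ω → Bool)
    (b : ℝ) : OnlyStopsAtSuccesses N U ξ (cutoffStrategy N U ξ b) := fun ω hω =>
  (cutoffStrategy_mem_or_eq_one N U ξ b ω).elim And.right fun h => absurd h hω.ne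

/-! ### From continuous time to the trial index -/

/-- The number of trials up to time `t` as a function of the number of trials and their epochs. -/
noncomputable def countOf (t : I) (x : ℕ × (ℕ → I)) : ℕ :=
  ∑ i ∈ Finset.range x.1, if x.2 i ≤ t then 1 else 0

theorem measurable_countOf (t : I) : Measurable (countOf t) := by
  refine measurable_from_prod_countable_right fun n => ?_
  change Measurable fun y : ℕ → I => ∑ i ∈ Finset.range n, if y i ≤ t then 1 else 0
  refine Finset.measurable_sum _ fun i _ => Measurable.ite ?_ measurable_const measurable_const
  exact measurableSet_le (measurable_pi_apply i) measurable_const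

theorem count_eq_countOf (t : I) (ω : Ω) :
    count N U t ω = countOf t (N ω, fun n => U (n + 1) ω) := by
  have : Finset.Icc 1 (N ω) = Finset.Ico 1 (N ω + 1) := by
    ext; simp
  rw [count, Finset.card_filter, this, Finset.sum_Ico_eq_sum_range, countOf]
  simp only [Nat.add_sub_cancel, add_comm 1]

/-- On the event that there are `k` trials up to time `t`, the information available at time `t`
is contained in the first `k` outcomes, the epochs, and the number of trials. -/
theorem measurableSet_inter_count_eq {t : I} (k : ℕ) {A : Set Ω}
    (hA : MeasurableSet[info N U ξ t] A) :
    MeasurableSet[historySigma N U ξ k] (A ∩ {ω | count N U t ω = k}) := by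
  have hS : MeasurableSet {x : (ℕ × (ℕ → I)) × (Finset.range k → Bool) | countOf t x.1 = k} :=
    ((measurable_countOf t).comp measurable_fst) (measurableSet_singleton k)
  have hS' : MeasurableSet[historySigma N U ξ k] {ω | count N U t ω = k} :=
    ⟨_, hS, by ext ω; simp [history, count_eq_countOf]⟩
  -- Good-sets argument: the events whose trace on {N_t = k} has the property form a σ-algebra, so
  -- the generators `observed` at times s ≤ t suffice.
  let m : MeasurableSpace Ω :=
    { MeasurableSet' := fun A =>
        MeasurableSet[historySigma N U ξ k] (A ∩ {ω | count N U t ω = k})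
      measurableSet_empty := by
        rw [Set.empty_inter]
        exact @MeasurableSet.empty _ (historySigma N U ξ k)
      measurableSet_compl := fun A hA => by
        have : Aᶜ ∩ {ω | count N U t ω = k} =
            {ω | count N U t ω = k} \ (A ∩ {ω | count N U t ω = k}) := by
          ext ω; simp; tauto
        rw [this]
        exact hS'.diff hA
      measurableSet_iUnion := fun f hf => by
        rw [Set.iUnion_inter]
        exact MeasurableSet.iUnion hf }
  suffices h : info N U ξ t ≤ m from h A hA
  refine iSup₂_le fun s hs => ?_
  rintro _ ⟨C, hC, rfl⟩
  -- Outcome j sits at coordinate j - 1. The default `false` is never used on {N_t = k}: there j ≤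
  -- N_s ≤ N_t = k.
  let H : (ℕ × (ℕ → I)) × (Finset.range k → Bool) → ℕ × (ℕ → Bool) := fun x =>
    (countOf s x.1, fun j => decide (1 ≤ j ∧ j ≤ countOf s x.1) &&
      if hj : j - 1 ∈ Finset.range k then x.2 ⟨j - 1, hj⟩ else false)
  have hH : Measurable H := by
    have hc : Measurable fun x : (ℕ × (ℕ → I)) × (Finset.range k → Bool) => countOf s x.1 :=
      (measurable_countOf s).comp measurable_fst
    refine hc.prodMk (measurable_pi_lambda _ fun j => ?_)
    have h1 : Measurable fun x : (ℕ × (ℕ → I)) × (Finset.range k → Bool) =>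
        decide (1 ≤ j ∧ j ≤ countOf s x.1) :=
      (Measurable.of_discrete (f := fun c : ℕ => decide (1 ≤ j ∧ j ≤ c))).comp hc
    have h2 : Measurable fun x : (ℕ × (ℕ → I)) × (Finset.range k → Bool) =>
        if hj : j - 1 ∈ Finset.range k then x.2 ⟨j - 1, hj⟩ else false := by
      by_cases hj : j - 1 ∈ Finset.range k
      · simp only [hj, dite_true]
        exact (measurable_pi_apply _).comp measurable_snd
      · simp only [hj, dite_false]
        exact measurable_const
    exact (Measurable.of_discrete (f := fun c : Bool × Bool => c.1 && c.2)).comp (h1.prodMk h2)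
  refine ⟨H ⁻¹' C ∩ _, (hH hC).inter hS, ?_⟩
  ext ω
  simp only [Set.mem_preimage, Set.mem_inter_iff, Set.mem_ofPred_eq]
  have e1 : countOf t (history N U ξ k ω).1 = count N U t ω := (count_eq_countOf t ω).symm
  have e2 : countOf s (history N U ξ k ω).1 = count N U s ω := (count_eq_countOf s ω).symm
  rw [e1]
  refine and_congr_left fun hω => ?_
  have : H (history N U ξ k ω) = observed N U ξ s ω := by
    refine Prod.ext e2 (funext fun j => ?_)
    simp only [H, observed, e2]
    by_cases hj : 1 ≤ j ∧ j ≤ count N U s ω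
    · have hj' : j - 1 ∈ Finset.range k := by
        have := count_mono (N := N) (U := U) hs ω
        rw [Finset.mem_range]
        omega
      simp only [hj', dite_true, history, Nat.sub_add_cancel hj.1]
    · simp [hj]
  rw [this]

/-- The event that `τ` stops not later than some time at which exactly `k` trials were observed. -/
def stoppedBy (N : Ω → ℕ) (U : ℕ → Ω → I) (τ : Ω → I) (k : ℕ) : Set Ω :=
  ⋃ q ∈ insert 1 (Set.range (TopologicalSpace.denseSeq I)),
    {ω | τ ω ≤ q} ∩ {ω | count N U q ω = k}

theorem measurableSet_stoppedBy {τ : Ω → I} (hτ : IsStrategy N U ξ τ) (k : ℕ) :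
    MeasurableSet[historySigma N U ξ k] (stoppedBy N U τ k) :=
  MeasurableSet.biUnion ((Set.countable_range _).insert 1)
    fun q _ => measurableSet_inter_count_eq k (hτ.adapted q)

theorem historySigma_mono {j k : ℕ} (h : j ≤ k) :
    historySigma N U ξ j ≤ historySigma N U ξ k := by
  rintro _ ⟨C, hC, rfl⟩
  let g : (ℕ × (ℕ → I)) × (Finset.range k → Bool) → (ℕ × (ℕ → I)) × (Finset.range j → Bool) :=
    fun x => (x.1, fun i => x.2 ⟨i, Finset.range_subset_range.2 h i.2⟩)
  have hg : Measurable g := measurable_fst.prodMk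
    (measurable_pi_lambda _ fun i => (measurable_pi_apply _).comp measurable_snd)
  exact ⟨g ⁻¹' C, hg hC, rfl⟩

theorem measurableSet_history_N (n k : ℕ) : MeasurableSet[historySigma N U ξ k] (N ⁻¹' {n}) :=
  ⟨{x | x.1.1 = n}, (measurable_fst.comp measurable_fst) (measurableSet_singleton n), rfl⟩

theorem measurableSet_history_outcome (k : ℕ) :
    MeasurableSet[historySigma N U ξ (k + 1)] {ω | ξ (k + 1) ω = true} :=
  ⟨{x | x.2 ⟨k, Finset.self_mem_range_succ k⟩ = true},
    measurableSet_eq_fun ((measurable_pi_apply _).comp measurable_snd) measurable_const, rfl⟩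

theorem measurableSet_disjointed_stoppedBy {τ : Ω → I} (hτ : IsStrategy N U ξ τ) (k : ℕ) :
    MeasurableSet[historySigma N U ξ k] (disjointed (stoppedBy N U τ) k) := by
  have : disjointed (stoppedBy N U τ) k =
      stoppedBy N U τ k \ ⋃ j ∈ Finset.range k, stoppedBy N U τ j := by
    rw [disjointed_apply]
    congr 1
    ext ω
    simp [Finset.sup_eq_iSup]
  rw [this]
  exact (measurableSet_stoppedBy hτ k).diff (Finset.measurableSet_biUnion _ fun j hj =>
    historySigma_mono (Finset.mem_range.1 hj).le _ (measurableSet_stoppedBy hτ j))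

theorem win_subset_disjointed {τ : Ω → I} {ω : Ω}
    (hinj : ∀ i j, 1 ≤ i → 1 ≤ j → U i ω = U j ω → i = j) (hω : ω ∈ win N U ξ τ) :
    ∃ k < N ω, ω ∈ disjointed (stoppedBy N U τ) (k + 1) ∧ ξ (k + 1) ω = true ∧
      ∀ i ∈ Finset.Ico (k + 1) (N ω), ξ (i + 1) ω = false := by
  obtain ⟨-, k, hk1, hk, hτ, hξ, hlast⟩ := hω
  obtain ⟨k, rfl⟩ : ∃ j, k = j + 1 := ⟨k - 1, by omega⟩
  refine ⟨k, hk, ?_, hξ, fun i hi => ?_⟩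
  · rw [disjointed_apply]
    refine ⟨?_, ?_⟩
    · have hle : k + 1 ≤ count N U (epoch N U (k + 1) ω) ω := (epoch_le_iff hk _).1 le_rfl
      -- After the final trial the time 1 is the witness, which is why it was inserted into the
      -- dense sequence; otherwise a dense time between two consecutive epochs is.
      rcases hk.eq_or_lt with h | h
      · refine Set.mem_biUnion (Set.mem_insert _ _) ⟨?_, ?_⟩
        · exact unitInterval.le_one'
        · rw [Set.mem_ofPred_eq, count_one, h]
      · obtain ⟨q, hq, h1, h2⟩ := (TopologicalSpace.denseRange_denseSeq I).exists_between
          (epoch_lt_epoch_succ hk1 h hinj)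
        refine Set.mem_biUnion (Set.mem_insert_of_mem _ hq) ⟨hτ.le.trans h1.le, ?_⟩
        have h3 := (epoch_le_iff hk q).1 h1.le
        have h4 := (epoch_le_iff (U := U) h q).not.1 (not_le.2 h2)
        simp only [Set.mem_ofPred_eq]
        omega
    · simp only [Finset.sup_eq_iSup, Set.iSup_eq_iUnion, Set.mem_iUnion, not_exists]
      intro j hj hmem
      obtain ⟨q, hq, h1, h2⟩ := Set.mem_iUnion₂.1 hmem
      simp only [Set.mem_ofPred_eq] at h1 h2
      rw [hτ, epoch_le_iff hk] at h1
      have := Finset.mem_Iio.1 hj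
      omega
  · have := Finset.mem_Ico.1 hi
    exact hlast _ (by omega) (by omega)

/-- With a single success after time `b`, the strategy with cutoff `b` wins. -/
theorem mem_win_cutoffStrategy {b : I} {ω : Ω} (hb : ∀ n, 1 ≤ n → U n ω ≠ b)
    (h1 : ∀ n, 1 ≤ n → U n ω ≠ 1) (hω : ω ∈ oneSuccess ξ (count N U b ω) (N ω)) :
    ω ∈ win N U ξ (cutoffStrategy N U ξ b) := by
  obtain ⟨j, hj, h⟩ := Set.mem_iUnion₂.1 hω
  rw [Finset.mem_Ico] at hj
  have hξ : ξ (j + 1) ω = true := by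
    rw [h j (Finset.mem_Ico.2 hj)]
    simp
  have hge : ∀ k, k ≤ N ω → count N U b ω < k → b ≤ epoch N U k ω := fun k hk hck =>
    (not_le.1 ((epoch_le_iff (U := U) hk b).not.2 (by omega))).le
  -- The count includes a trial at exactly b, while the cutoff rule may still accept it; `hb`
  -- excludes this tie.
  have huniq : ∀ k, 1 ≤ k → k ≤ N ω → b ≤ epoch N U k ω → ξ k ω = true → k = j + 1 := by
    intro k hk1 hk hbk hξk
    obtain ⟨n, hn, hn'⟩ := exists_eq_epoch (U := U) hk1 hk
    have hlt : b < epoch N U k ω := lt_of_le_of_ne hbk fun he => hb n hn (hn'.trans he.symm)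
    have hck : ¬ k ≤ count N U b ω := fun hle => absurd ((epoch_le_iff hk b).2 hle) (not_le.2 hlt)
    obtain ⟨i, rfl⟩ : ∃ i, k = i + 1 := ⟨k - 1, by omega⟩
    rw [h i (Finset.mem_Ico.2 ⟨by omega, by omega⟩), decide_eq_true_eq] at hξk
    rw [hξk]
  have hlt1 : epoch N U (j + 1) ω < 1 := by
    obtain ⟨n, hn, hn'⟩ := exists_eq_epoch (N := N) (U := U) (ω := ω) (k := j + 1)
      (by omega) (by omega)
    exact lt_of_le_of_ne unitInterval.le_one' fun he => h1 n hn (hn'.trans he)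
  have hle : cutoffStrategy N U ξ b ω ≤ epoch N U (j + 1) ω :=
    (cutoffStrategy_le_iff b hlt1 ω).2
      ⟨j + 1, by omega, by omega, hge _ (by omega) (by omega), le_rfl, hξ⟩
  have heq : cutoffStrategy N U ξ b ω = epoch N U (j + 1) ω := by
    rcases cutoffStrategy_mem_or_eq_one N U ξ b ω with ⟨h2, k, h3, h4, h5, h6⟩ | h2
    · rw [h5, huniq k h3 h4 (by rw [← h5]; exact h2) h6]
    · exact absurd (h2 ▸ hle) (not_le.2 hlt1)
  refine ⟨heq.trans_lt hlt1, j + 1, by omega, by omega, heq, hξ, fun i hi hi' => ?_⟩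
  by_contra hc
  have := huniq i (by omega) hi' (hge i hi' (by omega)) (by simpa using hc)
  omega

end Pathwise

/-! ### Upper bound for every strategy -/

section Model

variable {Ω : Type*} [MeasurableSpace Ω] {θ : ℝ} {P : Measure Ω}
  {N : Ω → ℕ} {U : ℕ → Ω → I} {ξ : ℕ → Ω → Bool}

theorem IsModel.ae_epoch_ne {p : ℕ → ℝ} (h : IsModel p P N U ξ) (c : I) :
    ∀ᵐ ω ∂P, ∀ n, 1 ≤ n → U n ω ≠ c := by
  refine ae_all_iff.2 fun n => ?_
  by_cases hn : 1 ≤ n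
  · have h0 : P (U n ⁻¹' {c}) = 0 := by
      rw [← Measure.map_apply (h.measurable_U n hn) (measurableSet_singleton c), h.law_U n hn]
      exact measure_singleton c
    filter_upwards [measure_eq_zero_iff_ae_notMem.1 h0] with ω hω _ using hω
  · exact Eventually.of_forall fun ω h' => absurd h' hn

theorem IsModel.ae_injective [IsProbabilityMeasure P] {p : ℕ → ℝ} (h : IsModel p P N U ξ) :
    ∀ᵐ ω ∂P, ∀ i j, 1 ≤ i → 1 ≤ j → U i ω = U j ω → i = j := by
  refine ae_all_iff.2 fun i => ae_all_iff.2 fun j => ?_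
  by_cases hij : 1 ≤ i ∧ 1 ≤ j ∧ i ≠ j
  · obtain ⟨hi, hj, hne⟩ := hij
    have hind : IndepFun (U i) (U j) P := by
      have := h.indep_U.indepFun (i := i - 1) (j := j - 1) (by omega)
      simpa only [Nat.sub_add_cancel hi, Nat.sub_add_cancel hj] using this
    rw [indepFun_iff_map_prod_eq_prod_map_map (h.measurable_U i hi).aemeasurable
      (h.measurable_U j hj).aemeasurable, h.law_U i hi, h.law_U j hj] at hind
    have hdiag : MeasurableSet (Set.diagonal I) := measurableSet_diagonal
    have h0 : P ((fun ω => (U i ω, U j ω)) ⁻¹' Set.diagonal I) = 0 := by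
      rw [← Measure.map_apply ((h.measurable_U i hi).prodMk (h.measurable_U j hj)) hdiag, hind,
        Measure.measure_prod_null hdiag]
      refine Eventually.of_forall fun x => ?_
      have : Prod.mk x ⁻¹' Set.diagonal I = {x} := by
        ext y
        simp [eq_comm]
      change volume (Prod.mk x ⁻¹' Set.diagonal I) = 0
      rw [this]
      exact measure_singleton x
    filter_upwards [measure_eq_zero_iff_ae_notMem.1 h0] with ω hω _ _ he
    exact absurd he hω
  · refine Eventually.of_forall fun ω hi hj _ => ?_
    by_contra hne
    exact hij ⟨hi, hj, hne⟩

/-- A supersolution of the optimality equation for `n` trials bounds the conditional winning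
probability, given that there are `n` trials, of any strategy. -/
theorem IsModel.real_win_inter_le [IsProbabilityMeasure P] (hθ : 0 < θ)
    (h : IsModel (profile θ) P N U ξ) {τ : Ω → I} (hτ : IsStrategy N U ξ τ) {n : ℕ} {w : ℕ → ℝ}
    (hw0 : ∀ k, 0 ≤ w k) (hw1 : ∀ k < n, w (k + 1) ≤ w k)
    (hw2 : ∀ k < n, w (k + 1) + θ / (θ + k) * (failProb θ (k + 1) n - w (k + 1)) ≤ w k) :
    P.real (win N U ξ τ ∩ N ⁻¹' {n}) ≤ P.real (N ⁻¹' {n}) * w 0 := by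
  -- C k covers the wins at trial k+1; it may also contain paths on which τ = 1, harmless for an
  -- upper bound. R k says that no earlier C j has occurred.
  let C : ℕ → Set Ω := fun k =>
    disjointed (stoppedBy N U τ) (k + 1) ∩ {ω | ξ (k + 1) ω = true} ∩ N ⁻¹' {n}
  let R : ℕ → Set Ω := fun k => N ⁻¹' {n} \ ⋃ j ∈ Finset.range k, C j
  have mC : ∀ k, MeasurableSet[historySigma N U ξ (k + 1)] (C k) := fun k =>
    ((measurableSet_disjointed_stoppedBy hτ (k + 1)).inter
      (measurableSet_history_outcome k)).inter (measurableSet_history_N n (k + 1))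
  have mR : ∀ k, MeasurableSet[historySigma N U ξ k] (R k) := fun k =>
    (measurableSet_history_N n k).diff (Finset.measurableSet_biUnion _ fun j hj =>
      historySigma_mono (Finset.mem_range.1 hj) _ (mC j))
  have hCR : ∀ k, C k ⊆ R k := by
    rintro k ω hω
    refine ⟨hω.2, ?_⟩
    simp only [Set.mem_iUnion, not_exists]
    intro j hj hω'
    have hne : j + 1 ≠ k + 1 := by
      have := Finset.mem_range.1 hj
      omega
    exact Set.disjoint_left.1 (disjoint_disjointed (stoppedBy N U τ) hne) hω'.1.1 hω.1.1
  have hR : ∀ k, P.real (R (k + 1)) = P.real (R k) - P.real (C k) := by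
    intro k
    have : R (k + 1) = R k \ C k := by
      ext ω
      simp only [R, Finset.range_add_one, Finset.set_biUnion_insert, Set.mem_sdiff, Set.mem_union,
        not_or]
      tauto
    rw [this, measureReal_sdiff (hCR k) (h.historySigma_le _ _ (mC k))]
  -- The decision at trial k+1 may use its outcome, so C k is not independent of it; but it lies
  -- inside R k with a success, and R k depends only on the first k outcomes.
  have hCp : ∀ k, P.real (C k) ≤ P.real (R k) * (θ / (θ + k)) := by
    intro k
    rw [← h.real_inter_success hθ (mR k)]
    exact measureReal_mono fun ω hω => ⟨hCR k hω, hω.1.2⟩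
  have hstep : ∀ k < n, P.real (C k) * failProb θ (k + 1) n ≤
      P.real (R k) * w k - P.real (R (k + 1)) * w (k + 1) := by
    intro k hk
    rw [hR]
    have hR0 : 0 ≤ P.real (R k) := measureReal_nonneg
    have hC0 : 0 ≤ P.real (C k) := measureReal_nonneg
    -- The claim is P(C)(F - w') ≤ P(R)(w - w'), where F = `failProb θ (k + 1) n`, w' = `w (k + 1)`,
    -- w = `w k`. If F ≤ w', monotonicity of w suffices; otherwise use `hCp` and then the
    -- supersolution inequality.
    rcases le_total (failProb θ (k + 1) n) (w (k + 1)) with hc | hc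
    · nlinarith [mul_nonneg hC0 (sub_nonneg.2 hc), mul_nonneg hR0 (sub_nonneg.2 (hw1 k hk))]
    · nlinarith [mul_le_mul_of_nonneg_right (hCp k) (sub_nonneg.2 hc),
        mul_le_mul_of_nonneg_left (hw2 k hk) hR0]
  have hsub : (win N U ξ τ ∩ N ⁻¹' {n} : Set Ω) ≤ᵐ[P]
      (⋃ k ∈ Finset.range n, C k ∩ {ω | ∀ i ∈ Finset.Ico (k + 1) n, ξ (i + 1) ω = false} :
        Set Ω) := by
    filter_upwards [h.ae_injective] with ω hinj hω
    obtain ⟨k, hk, h1, h2, h3⟩ := win_subset_disjointed hinj hω.1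
    have hn : N ω = n := hω.2
    rw [hn] at hk h3
    exact Set.mem_biUnion (Finset.mem_coe.2 (Finset.mem_range.2 hk)) ⟨⟨⟨h1, h2⟩, hn⟩, h3⟩
  calc P.real (win N U ξ τ ∩ N ⁻¹' {n})
      ≤ P.real (⋃ k ∈ Finset.range n,
          C k ∩ {ω | ∀ i ∈ Finset.Ico (k + 1) n, ξ (i + 1) ω = false}) :=
        ENNReal.toReal_mono (measure_ne_top _ _) (measure_mono_ae hsub)
    _ ≤ ∑ k ∈ Finset.range n,
          P.real (C k ∩ {ω | ∀ i ∈ Finset.Ico (k + 1) n, ξ (i + 1) ω = false}) :=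
        measureReal_biUnion_finset_le _ _
    _ = ∑ k ∈ Finset.range n, P.real (C k) * failProb θ (k + 1) n :=
        Finset.sum_congr rfl fun k _ => h.real_inter_fail hθ n (mC k)
    _ ≤ ∑ k ∈ Finset.range n, (P.real (R k) * w k - P.real (R (k + 1)) * w (k + 1)) :=
        Finset.sum_le_sum fun k hk => hstep k (Finset.mem_range.1 hk)
    _ = P.real (R 0) * w 0 - P.real (R n) * w n :=
        Finset.sum_range_sub' (fun k => P.real (R k) * w k) n
    _ ≤ P.real (N ⁻¹' {n}) * w 0 := by
        have : R 0 = N ⁻¹' {n} := by simp [R]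
        rw [this]
        linarith [mul_nonneg (measureReal_nonneg (μ := P) (s := R n)) (hw0 n)]

theorem hasSum_real_inter_fiber [IsFiniteMeasure P] (hN : Measurable N) (A : Set Ω) (M : ℕ) :
    HasSum (fun n : Set.Ici M => P.real (A ∩ N ⁻¹' {(n : ℕ)})) (P.real (A ∩ {ω | M ≤ N ω})) := by
  have h1 := tsum_measure_preimage_singleton (μ := P.restrict A) (Set.to_countable (Set.Ici M))
    (f := N) fun n _ => hN (measurableSet_singleton n)
  have h2 : ∀ S : Set ℕ, P.restrict A (N ⁻¹' S) = P (A ∩ N ⁻¹' S) := fun S => by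
    rw [Measure.restrict_apply (hN MeasurableSet.of_discrete), Set.inter_comm]
  simp only [h2] at h1
  have h3 : ∑' n : Set.Ici M, P (A ∩ N ⁻¹' {(n : ℕ)}) ≠ ⊤ := h1 ▸ measure_ne_top _ _
  have h4 := ENNReal.hasSum_toReal h3
  rw [← ENNReal.tsum_toReal_eq fun n => measure_ne_top _ _, h1] at h4
  exact h4

theorem real_le_of_fiber_le [IsProbabilityMeasure P] (hN : Measurable N) {A : Set Ω} {M : ℕ}
    {V : ℝ} (h : ∀ n, M ≤ n → P.real (A ∩ N ⁻¹' {n}) ≤ P.real (N ⁻¹' {n}) * V) :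
    P.real (A ∩ {ω | M ≤ N ω}) ≤ P.real {ω | M ≤ N ω} * V := by
  have h1 := (hasSum_real_inter_fiber (P := P) hN Set.univ M).mul_right V
  simp only [Set.univ_inter] at h1
  exact hasSum_le (fun n : Set.Ici M => h n.1 n.2) (hasSum_real_inter_fiber hN A M) h1

theorem le_real_of_le_fiber [IsProbabilityMeasure P] (hN : Measurable N) {A : Set Ω} {M : ℕ}
    {V : ℝ} (h : ∀ n, M ≤ n → P.real (N ⁻¹' {n}) * V ≤ P.real (A ∩ N ⁻¹' {n})) :
    P.real {ω | M ≤ N ω} * V ≤ P.real A := by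
  have h1 := (hasSum_real_inter_fiber (P := P) hN Set.univ M).mul_right V
  simp only [Set.univ_inter] at h1
  exact (hasSum_le (fun n : Set.Ici M => h n.1 n.2) h1 (hasSum_real_inter_fiber hN A M)).trans
    (measureReal_mono Set.inter_subset_left)

/-- Up to the probability that there are few trials, no strategy wins with probability
exceeding `e⁻¹` substantially. -/
theorem exists_forall_real_win_le {θ : ℝ} (hθ : 0 < θ) {ε : ℝ} (hε : 0 < ε) :
    ∃ M : ℕ, ∀ {Ω : Type*} [MeasurableSpace Ω] {P : Measure Ω} [IsProbabilityMeasure P]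
      {N : Ω → ℕ} {U : ℕ → Ω → I} {ξ : ℕ → Ω → Bool} {τ : Ω → I},
      IsModel (profile θ) P N U ξ → IsStrategy N U ξ τ →
      P.real (win N U ξ τ) ≤ Real.exp (-1) + ε + (1 - P.real {ω | M ≤ N ω}) := by
  obtain ⟨M, hM⟩ := exists_supersolution_le hθ hε
  refine ⟨M, fun {Ω _ P _ N U ξ τ} h hτ => ?_⟩
  have h1 : P.real (win N U ξ τ ∩ {ω | M ≤ N ω}) ≤
      P.real {ω | M ≤ N ω} * (Real.exp (-1) + ε) := by
    refine real_le_of_fiber_le h.measurable_N fun n hn => ?_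
    obtain ⟨w, hw0, hw1, hw2, hw3⟩ := hM n hn
    exact (h.real_win_inter_le hθ hτ hw0 hw1 hw2).trans
      (mul_le_mul_of_nonneg_left hw3 measureReal_nonneg)
  have h2 : P.real {ω | M ≤ N ω} * (Real.exp (-1) + ε) ≤ Real.exp (-1) + ε :=
    mul_le_of_le_one_left (by positivity) measureReal_le_one
  have hm : MeasurableSet {ω | M ≤ N ω} := measurableSet_le measurable_const h.measurable_N
  have h3 : P.real (win N U ξ τ \ {ω | M ≤ N ω}) ≤ 1 - P.real {ω | M ≤ N ω} := by
    rw [← probReal_compl_eq_one_sub hm]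
    exact measureReal_mono fun ω hω => hω.2
  linarith [measureReal_inter_add_sdiff (μ := P) (s := win N U ξ τ) hm]

end Model

/-! ### Lower bound for the cutoff rule -/

section Model

variable {Ω : Type*} [MeasurableSpace Ω] {θ : ℝ} {P : Measure Ω}
  {N : Ω → ℕ} {U : ℕ → Ω → I} {ξ : ℕ → Ω → Bool}

/-- The fraction of the first `n` epochs up to time `b` concentrates at `b`. -/
theorem IsModel.real_deviation_le [IsProbabilityMeasure P] {p : ℕ → ℝ}
    (h : IsModel p P N U ξ) (b : I) {n : ℕ} (hn : 1 ≤ n) {δ : ℝ} (hδ : 0 < δ) :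
    P.real {ω | δ ≤ |(countOf b (n, fun i => U (i + 1) ω) : ℝ) / n - b|} ≤
      1 / (4 * n * δ ^ 2) := by
  have hn0 : (0 : ℝ) < n := by exact_mod_cast hn
  let f : I → ℝ := (Set.Iic b).indicator fun _ => 1
  have hf : Measurable f := measurable_const.indicator measurableSet_Iic
  have hf01 : ∀ x, f x ∈ Set.Icc (0 : ℝ) 1 := fun x =>
    ⟨Set.indicator_nonneg (fun _ _ => zero_le_one) x,
      Set.indicator_le_self' (fun _ _ => zero_le_one) x⟩
  let Y : ℕ → Ω → ℝ := fun i ω => f (U (i + 1) ω)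
  have mU : ∀ i, Measurable (U (i + 1)) := fun i => h.measurable_U _ (by omega)
  have mY : ∀ i, Measurable (Y i) := fun i => hf.comp (mU i)
  have hY2 : ∀ i, MemLp (Y i) 2 P := fun i =>
    MemLp.of_bound (mY i).aestronglyMeasurable 1 (Eventually.of_forall fun ω => by
      have := hf01 (U (i + 1) ω)
      rw [Real.norm_eq_abs, abs_of_nonneg this.1]
      exact this.2)
  have hmean : ∀ i, ∫ ω, Y i ω ∂P = b := fun i => by
    have h1 : ∫ x, f x ∂(P.map (U (i + 1))) = ∫ ω, Y i ω ∂P :=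
      integral_map (mU i).aemeasurable hf.aestronglyMeasurable
    rw [← h1, h.law_U _ (by omega), integral_indicator_const _ measurableSet_Iic,
      measureReal_def, unitInterval.volume_Iic, ENNReal.toReal_ofReal b.2.1]
    simp
  -- A variable with values in [0,1] has variance at most (1/2)²; this is the 4 in the bound.
  have hvar : ∀ i, variance (Y i) P ≤ 1 / 4 := fun i =>
    (variance_le_sq_of_bounded (Eventually.of_forall fun ω => hf01 (U (i + 1) ω))
      (mY i).aemeasurable).trans (by norm_num)
  let X : Ω → ℝ := ∑ i ∈ Finset.range n, Y i
  have hX2 : MemLp X 2 P := memLp_finsetSum' _ fun i _ => hY2 i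
  have hXmean : ∫ ω, X ω ∂P = n * b := by
    simp only [X, Finset.sum_apply]
    rw [integral_finsetSum _ fun i _ => (hY2 i).integrable (by norm_num)]
    simp [hmean]
  have hXvar : variance X P ≤ n * (1 / 4) := by
    rw [IndepFun.variance_sum (fun i _ => hY2 i) fun i _ j _ hij =>
      (h.indep_U.indepFun hij).comp hf hf]
    exact (Finset.sum_le_sum fun i _ => hvar i).trans (by simp)
  have hXcount : ∀ ω, X ω = countOf b (n, fun i => U (i + 1) ω) := fun ω => by
    simp only [X, Y, f, Finset.sum_apply, countOf, Set.indicator_apply, Set.mem_Iic]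
    push_cast
    rfl
  have hset : {ω | δ ≤ |(countOf b (n, fun i => U (i + 1) ω) : ℝ) / n - b|} =
      {ω | n * δ ≤ |X ω - ∫ ω, X ω ∂P|} := by
    ext ω
    rw [Set.mem_ofPred_eq, Set.mem_ofPred_eq, hXmean, hXcount,
      show (countOf b (n, fun i => U (i + 1) ω) : ℝ) - n * b =
        n * ((countOf b (n, fun i => U (i + 1) ω) : ℝ) / n - b) by field_simp,
      abs_mul, abs_of_pos hn0, mul_le_mul_iff_right₀ hn0]
  rw [hset]
  have hcheb := ENNReal.toReal_mono ENNReal.ofReal_ne_top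
    (meas_ge_le_variance_div_sq hX2 (c := n * δ) (by positivity))
  rw [ENNReal.toReal_ofReal (div_nonneg (variance_nonneg _ _) (sq_nonneg _))] at hcheb
  refine hcheb.trans ?_
  calc variance X P / (n * δ) ^ 2 ≤ n * (1 / 4) / (n * δ) ^ 2 := by gcongr
    _ = 1 / (4 * n * δ ^ 2) := by field_simp

/-- A lower bound for the conditional winning probability of the strategy with cutoff `b`, given
that there are `n` trials. -/
theorem IsModel.le_real_win_cutoffStrategy_inter [IsProbabilityMeasure P] (hθ : 0 < θ)
    (h : IsModel (profile θ) P N U ξ) (b : I) {n : ℕ} (hn : 1 ≤ n) {δ : ℝ} (hδ : 0 < δ) {V : ℝ}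
    (hV : 0 ≤ V) (hs : ∀ k ≤ n, |(k : ℝ) / n - b| < δ →
      1 ≤ k ∧ V ≤ failProb θ k n * oddsSum θ k n) :
    P.real (N ⁻¹' {n}) * ((1 - 1 / (4 * n * δ ^ 2)) * V) ≤
      P.real (win N U ξ (cutoffStrategy N U ξ b) ∩ N ⁻¹' {n}) := by
  classical
  let K : Finset ℕ := (Finset.range (n + 1)).filter fun k => |(k : ℝ) / n - b| < δ
  let C : ℕ → Set Ω := fun k => N ⁻¹' {n} ∩ {ω | count N U b ω = k}
  have mC : ∀ k, MeasurableSet[historySigma N U ξ k] (C k) := fun k => by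
    have := measurableSet_inter_count_eq (N := N) (U := U) (ξ := ξ) (t := b) k
      (@MeasurableSet.univ _ (info N U ξ b))
    rw [Set.univ_inter] at this
    exact (measurableSet_history_N n k).inter this
  have mC' : ∀ k, MeasurableSet (C k) := fun k => h.historySigma_le k _ (mC k)
  have hdisj : Pairwise (Function.onFun Disjoint C) := fun j k hjk =>
    Set.disjoint_left.2 fun ω hj hk => hjk (hj.2.symm.trans hk.2)
  have hsub : (⋃ k ∈ K, C k ∩ oneSuccess ξ k n : Set Ω) ≤ᵐ[P]
      (win N U ξ (cutoffStrategy N U ξ b) ∩ N ⁻¹' {n} : Set Ω) := by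
    filter_upwards [h.ae_epoch_ne b, h.ae_epoch_ne 1] with ω hb h1 hω
    obtain ⟨k, -, ⟨hωn, hωk⟩, hω1⟩ := Set.mem_iUnion₂.1 hω
    refine ⟨mem_win_cutoffStrategy hb h1 ?_, hωn⟩
    rw [show count N U b ω = k from hωk, show N ω = n from hωn]
    exact hω1
  -- S uses the first n epochs with n fixed in place of N, so it is independent of {N = n}, on which
  -- it describes the actual count.
  let S : Set Ω := {ω | δ ≤ |(countOf b (n, fun i => U (i + 1) ω) : ℝ) / n - b|}
  let S₀ : Set (ℕ → I) := {x | δ ≤ |(countOf b (n, x) : ℝ) / n - b|}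
  have mS₀ : MeasurableSet S₀ := by
    have : Measurable fun x : ℕ → I => countOf b (n, x) :=
      (measurable_countOf b).comp measurable_prodMk_left
    exact (this (MeasurableSet.of_discrete (s := {c : ℕ | δ ≤ |(c : ℝ) / n - b|})))
  have mU : Measurable fun ω (i : ℕ) => U (i + 1) ω :=
    measurable_pi_lambda _ fun i => h.measurable_U _ (by omega)
  have hNU : IndepFun N (fun ω (i : ℕ) => U (i + 1) ω) P :=
    h.indep_N.comp measurable_id measurable_fst
  have hprod : P.real (N ⁻¹' {n} ∩ Sᶜ) = P.real (N ⁻¹' {n}) * P.real Sᶜ := by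
    have := hNU.measure_inter_preimage_eq_mul {n} S₀ᶜ (measurableSet_singleton n) mS₀.compl
    rw [measureReal_def, measureReal_def, measureReal_def, ← ENNReal.toReal_mul]
    exact congrArg ENNReal.toReal this
  have hunion : N ⁻¹' {n} ∩ Sᶜ ⊆ ⋃ k ∈ K, C k := by
    rintro ω ⟨hωn, hωS⟩
    have hωn' : N ω = n := hωn
    have hc : count N U b ω = countOf b (n, fun i => U (i + 1) ω) := by
      rw [count_eq_countOf, hωn']
    refine Set.mem_biUnion (x := count N U b ω) ?_ ⟨hωn, rfl⟩
    rw [Finset.mem_coe, Finset.mem_filter, Finset.mem_range, hc]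
    refine ⟨?_, not_le.1 hωS⟩
    rw [← hc, Nat.lt_succ_iff, ← hωn']
    exact count_le b ω
  have hScompl : 1 - 1 / (4 * n * δ ^ 2) ≤ P.real Sᶜ := by
    rw [probReal_compl_eq_one_sub (show MeasurableSet S from mU mS₀)]
    linarith [h.real_deviation_le b hn hδ]
  calc P.real (N ⁻¹' {n}) * ((1 - 1 / (4 * n * δ ^ 2)) * V)
      ≤ P.real (N ⁻¹' {n}) * (P.real Sᶜ * V) :=
        mul_le_mul_of_nonneg_left (mul_le_mul_of_nonneg_right hScompl hV) measureReal_nonneg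
    _ = P.real (N ⁻¹' {n} ∩ Sᶜ) * V := by rw [hprod, mul_assoc]
    _ ≤ P.real (⋃ k ∈ K, C k) * V :=
        mul_le_mul_of_nonneg_right (measureReal_mono hunion (measure_ne_top _ _)) hV
    _ = ∑ k ∈ K, P.real (C k) * V := by
        rw [measureReal_biUnion_finset (fun j _ k _ hjk => hdisj hjk) fun k _ => mC' k,
          Finset.sum_mul]
    _ ≤ ∑ k ∈ K, P.real (C k ∩ oneSuccess ξ k n) := by
        refine Finset.sum_le_sum fun k hk => ?_
        obtain ⟨hk1, hk2⟩ := Finset.mem_filter.1 hk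
        obtain ⟨h1, h2⟩ := hs k (Nat.lt_succ_iff.1 (Finset.mem_range.1 hk1)) hk2
        rw [h.real_inter_oneSuccess hθ h1 n (mC k)]
        exact mul_le_mul_of_nonneg_left h2 measureReal_nonneg
    _ = P.real (⋃ k ∈ K, C k ∩ oneSuccess ξ k n) :=
        (measureReal_biUnion_finset (fun j _ k _ hjk => (hdisj hjk).mono Set.inter_subset_left
          Set.inter_subset_left) fun k _ => (mC' k).inter (h.measurableSet_oneSuccess k n)).symm
    _ ≤ P.real (win N U ξ (cutoffStrategy N U ξ b) ∩ N ⁻¹' {n}) :=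
        ENNReal.toReal_mono (measure_ne_top _ _) (measure_mono_ae hsub)

/-- The strategy with cutoff `exp (-1 / θ)` wins with probability arbitrarily close to `e⁻¹`
if there are many trials with high probability. -/
theorem exists_le_real_win_cutoffStrategy {θ : ℝ} (hθ : 0 < θ) (b : I)
    (hb : (b : ℝ) = Real.exp (-1 / θ)) {a : ℝ} (ha0 : 0 ≤ a) (ha : a < Real.exp (-1)) :
    ∃ M : ℕ, ∃ c > a, ∀ {Ω : Type*} [MeasurableSpace Ω] {P : Measure Ω} [IsProbabilityMeasure P]
      {N : Ω → ℕ} {U : ℕ → Ω → I} {ξ : ℕ → Ω → Bool}, IsModel (profile θ) P N U ξ →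
      P.real {ω | M ≤ N ω} * c ≤ P.real (win N U ξ (cutoffStrategy N U ξ b)) := by
  obtain ⟨V, haV, hVe⟩ := exists_between ha
  have hV : 0 ≤ V := ha0.trans haV.le
  obtain ⟨δ, hδ, M, hM⟩ := exists_le_failProb_mul_oddsSum hθ (sub_pos.2 hVe)
  have ht : Tendsto (fun m : ℕ => (1 - 1 / (4 * (m : ℝ) * δ ^ 2)) * V) atTop (𝓝 V) := by
    have h1 : Tendsto (fun m : ℕ => 4 * (m : ℝ) * δ ^ 2) atTop atTop :=
      (tendsto_natCast_atTop_atTop.const_mul_atTop (by norm_num)).atTop_mul_const (by positivity)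
    have h2 := ((tendsto_const_nhds (x := (1 : ℝ))).sub
      ((tendsto_const_nhds (x := (1 : ℝ))).div_atTop h1)).mul_const V
    simpa using h2
  obtain ⟨m, hm, hm1⟩ := ((ht.eventually_const_lt haV).and
    (eventually_ge_atTop (max M 1))).exists
  refine ⟨m, _, hm, fun {Ω _ P _ N U ξ} h => le_real_of_le_fiber h.measurable_N fun n hn => ?_⟩
  have hm0 : (0 : ℝ) < m := by exact_mod_cast le_of_max_le_right hm1
  have hmn : (m : ℝ) ≤ n := by exact_mod_cast hn
  refine le_trans (mul_le_mul_of_nonneg_left (mul_le_mul_of_nonneg_right ?_ hV)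
    measureReal_nonneg) (h.le_real_win_cutoffStrategy_inter hθ b
      ((le_of_max_le_right hm1).trans hn) hδ hV fun k hk hkb => ?_)
  · gcongr
  · obtain ⟨h1, h2⟩ := hM n k ((le_of_max_le_left hm1).trans hn)
      ((le_of_max_le_right hm1).trans hn) hk (by rwa [← hb])
    exact ⟨h1, by linarith⟩

theorem real_win_le_optimalWin [IsProbabilityMeasure P] {τ : Ω → I} (hτ : IsStrategy N U ξ τ) :
    P.real (win N U ξ τ) ≤ optimalWin N U ξ P :=
  le_csSup ⟨1, by rintro _ ⟨τ, -, rfl⟩; exact measureReal_le_one⟩ ⟨τ, hτ, rfl⟩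

end Model

end LastSuccess

/-! ### Squeezing both winning probabilities -/

theorem mainTheorem9 (θ : ℝ) (hθ : 0 < θ) {ι : Type*} (l : Filter ι)
    (Ω : ι → Type*) [∀ i, MeasurableSpace (Ω i)]
    (P : ∀ i, Measure (Ω i)) [∀ i, IsProbabilityMeasure (P i)]
    (N : ∀ i, Ω i → ℕ) (U : ∀ i, ℕ → Ω i → I) (ξ : ∀ i, ℕ → Ω i → Bool)
    (hmodel : ∀ i, LastSuccess.IsModel (LastSuccess.profile θ) (P i) (N i) (U i) (ξ i))
    (hN : ∀ K : ℕ, Tendsto (fun i => (P i).real {ω | K ≤ N i ω}) l (𝓝 1)) :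
    (∀ i, LastSuccess.IsStrategy (N i) (U i) (ξ i)
        (LastSuccess.cutoffStrategy (N i) (U i) (ξ i) (Real.exp (-1 / θ))) ∧
      LastSuccess.OnlyStopsAtSuccesses (N i) (U i) (ξ i)
        (LastSuccess.cutoffStrategy (N i) (U i) (ξ i) (Real.exp (-1 / θ)))) ∧
    Tendsto (fun i => (P i).real (LastSuccess.win (N i) (U i) (ξ i)
        (LastSuccess.cutoffStrategy (N i) (U i) (ξ i) (Real.exp (-1 / θ)))))
      l (𝓝 (Real.exp (-1))) ∧
    Tendsto (fun i => LastSuccess.optimalWin (N i) (U i) (ξ i) (P i))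
      l (𝓝 (Real.exp (-1))) := by

  have hb0 : Real.exp (-1 / θ) ∈ I :=
    ⟨(Real.exp_pos _).le, Real.exp_le_one_iff.2 (div_nonpos_of_nonpos_of_nonneg
      (by norm_num) hθ.le)⟩
  have hstrat := fun i => LastSuccess.isStrategy_cutoffStrategy (N i) (U i) (ξ i) ⟨_, hb0⟩
  have hlow : ∀ a < Real.exp (-1), ∀ᶠ i in l, a < (P i).real (LastSuccess.win (N i) (U i) (ξ i)
      (LastSuccess.cutoffStrategy (N i) (U i) (ξ i) (Real.exp (-1 / θ)))) := by
    intro a ha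
    -- The maximum with 0 meets the nonnegativity required of the lower level.
    obtain ⟨a', haa', ha'⟩ := exists_between (max_lt ha (Real.exp_pos (-1)))
    obtain ⟨M, c, hc, hM⟩ := LastSuccess.exists_le_real_win_cutoffStrategy hθ ⟨_, hb0⟩ rfl
      ((le_max_right a 0).trans haa'.le) ha'
    have ht := (hN M).mul_const c
    rw [one_mul] at ht
    filter_upwards [ht.eventually_const_lt hc] with i hi
    exact ((le_max_left a 0).trans_lt haa').trans (hi.trans_le (hM (hmodel i)))
  have hopt : ∀ i, (P i).real (LastSuccess.win (N i) (U i) (ξ i)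
      (LastSuccess.cutoffStrategy (N i) (U i) (ξ i) (Real.exp (-1 / θ)))) ≤
      LastSuccess.optimalWin (N i) (U i) (ξ i) (P i) := fun i =>
    LastSuccess.real_win_le_optimalWin (hstrat i)
  have hup : ∀ a > Real.exp (-1), ∀ᶠ i in l,
      LastSuccess.optimalWin (N i) (U i) (ξ i) (P i) < a := by
    intro a ha
    obtain ⟨M, hM⟩ := LastSuccess.exists_forall_real_win_le hθ (half_pos (sub_pos.2 ha))
    -- Half of the gap a - 1/e is spent on ε; the other half absorbs P(N < M) → 0.
    have ht := ((hN M).const_sub 1).const_add (Real.exp (-1) + (a - Real.exp (-1)) / 2)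
    filter_upwards [ht.eventually_lt_const (show _ < a by linarith)] with i hi
    refine lt_of_le_of_lt (csSup_le ⟨_, _, hstrat i, rfl⟩ ?_) hi
    rintro _ ⟨τ, hτ, rfl⟩
    exact hM (hmodel i) hτ
  refine ⟨fun i => ⟨hstrat i, LastSuccess.onlyStopsAtSuccesses_cutoffStrategy _ _ _ _⟩,
    tendsto_order.2 ⟨hlow, fun a ha => (hup a ha).mono fun i hi => (hopt i).trans_lt hi⟩,
    tendsto_order.2 ⟨fun a ha => (hlow a ha).mono fun i hi => hi.trans_le (hopt i), hup⟩⟩
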